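/- Let $M$ be a von Neumann algebra on a Hilbert space, $A\subseteq M$ a commutative von Neumann subalgebra (with the same unit), and $E:M\to A$ a faithful normal conditional expectation. For a partial isometry $v$ put $l(v)=vv^*$ and $r(v)=v^*v$. The full normalizing groupoid of $A$ in $M$ is $$\mathcal{G}(M\supseteq A)=\{v\in M:\ v^*v,\,vv^*\ \text{are projections of } A,\ vAv^*=Avv^*\}.$$ An $E$-groupoid is a subset $\mathcal{G}\subseteq\mathcal{G}(M\supseteq A)$ that is closed under products and adjoints, contains every partial isometry of $A$, is closed under $\sigma$-strong* sums $\sum_k u_k$ of families of its elements whose left supports $l(u_k)$ are mutually orthogonal and whose right supports $r(u_k)$ are mutually orthogonal, and is such that for every $u\in\mathcal{G}$ there is a projection $e\in A$ with $e\le l(u)$ and $E(u)=eu$, and $E(uxu^*)=uE(x)u^*$ for every $x\in M$. Collections are families indexed by an at most countable set (the same operator may occur several times), and $\sqcup$ is their disjoint union. A graphing of $\mathcal{G}$ is such a collection $\mathcal{U}$ of elements of $\mathcal{G}$ with $\mathcal{G}''=A\vee\mathcal{U}''$ as von Neumann algebras. A treeing is a collection $\mathcal{U}$ of elements of $\mathcal{G}(M\supseteq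 A)$ with $E(w)=0$ for every nonempty formally reduced word $w$ in $\mathcal{U}\sqcup\mathcal{U}^*$ (with $u^*$ regarded as the formal inverse of $u$). For a projection $p\in A$, the set $p\mathcal{G}p=\{pup:u\in\mathcal{G}\}$ is considered with respect to the inclusion $Ap\subseteq pMp$ of von Neumann algebras with unit $p$ and the restriction of $E$ to $pMp$; its graphings, and treeings for $Ap\subseteq pMp$, are defined in the same way. For a faithful normal tracial state $\tau$ on $M$, the $\tau$-cost of a collection $\mathcal{U}$ is $C_\tau(\mathcal{U})=\sum_{u\in\mathcal{U}}\tfrac12\tau\big(l(u)+r(u)\big)\in[0,\infty]$; for collections in $pMp$ the same formula, with $\tau$ not renormalized, is used. Let $\mathcal{G}$ be an $E$-groupoid with $\mathcal{G}''=M$, let $\tau$ be a faithful normal tracial state on $M$ with $\tau\circ E=\tau$, let $p\in A$ be a projection whose central support in $M$ is $1$, and let $\mathcal{U}$ be a graphing of $\mathcal{G}$. Then there are a treeing $\mathcal{U}_v$ and a graphing $\mathcal{U}_h$ of $p\mathcal{G}p$ such that: (a) $p$ is an abelian projection of $M_v:=A\vee\mathcal{U}_v''$, and the central support of $p$ in $M_v$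 is $1$; (b) for every graphing $\mathcal{V}$ of $p\mathcal{G}p$, the collection $\mathcal{U}_v\sqcup\mathcal{V}$ is a graphing of $\mathcal{G}$; (c) for every graphing $\mathcal{V}$ of $p\mathcal{G}p$, the collection $\mathcal{U}_v\sqcup\mathcal{V}$ is a treeing if and only if $\mathcal{V}$ is a treeing; (d) $C_\tau(\mathcal{U})=C_\tau(\mathcal{U}_v)+C_\tau(\mathcal{U}_h)$ and $C_\tau(\mathcal{U}_v)=1-\tau(p)$. -/

import Mathlib

open scoped ComplexOrder

namespace NormalizingGroupoid

variable {H : Type*} [NormedAddCommGroup H] [InnerProductSpace ℂ H] [CompleteSpace H]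

/-- For a projection `e` on `H` and a set `S` of operators `x = e x e` on `H` (equivalently, of
operators on the Hilbert space `e H`): the von Neumann algebra on `e H`, with unit `e`, generated
by `S`. Its elements are again viewed as operators `x = e x e` on `H`. For `e = 1` this is the
double commutant of `S ∪ S*`. -/
def vnGen (e : H →L[ℂ] H) (S : Set (H →L[ℂ] H)) : Set (H →L[ℂ] H) :=
  {x | x ∈ Set.centralizer (Set.centralizer (S ∪ star '' S ∪ {e})) ∧ e * x * e = x}

/-- The restriction of `φ` to `M` belongs to the predual of `M`, i.e. is `σ`-weakly continuous.
(A linear functional on `M` is represented by any of its linear extensions to all operators.) -/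
def IsNormalOn (M : VonNeumannAlgebra H) (φ : (H →L[ℂ] H) →ₗ[ℂ] ℂ) : Prop :=
  ∃ ξ η : ℕ → H, Summable (fun n => ‖ξ n‖ ^ 2) ∧ Summable (fun n => ‖η n‖ ^ 2) ∧
    ∀ x ∈ M, φ x = ∑' n, inner ℂ (η n) (x (ξ n))

/-- `τ` restricts to a faithful normal tracial state on `M`. -/
structure IsFaithfulTracialState (M : VonNeumannAlgebra H)
    (τ : (H →L[ℂ] H) →ₗ[ℂ] ℂ) : Prop where
  map_one : τ 1 = 1
  nonneg : ∀ x ∈ M, 0 ≤ τ (star x * x)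
  faithful : ∀ x ∈ M, τ (star x * x) = 0 → x = 0
  tracial : ∀ x ∈ M, ∀ y ∈ M, τ (x * y) = τ (y * x)
  normal : IsNormalOn M τ

/-- `E` restricts to a faithful normal conditional expectation from `M` onto `A ⊆ M`. (Only the
restriction to `M` matters; a linear map on `M` is represented by any of its linear extensions to
all operators.) -/
structure IsCondExp (M A : VonNeumannAlgebra H)
    (E : (H →L[ℂ] H) →ₗ[ℂ] (H →L[ℂ] H)) : Prop where
  map_mem : ∀ x ∈ M, E x ∈ A
  map_self : ∀ a ∈ A, E a = a
  bimodule : ∀ a ∈ A, ∀ b ∈ A, ∀ x ∈ M, E (a * x * b) = a * E x * b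
  positive : ∀ x ∈ M, (E (star x * x)).IsPositive
  faithful : ∀ x ∈ M, E (star x * x) = 0 → x = 0
  normal : ∀ φ : (H →L[ℂ] H) →ₗ[ℂ] ℂ, IsNormalOn A φ → IsNormalOn M (φ ∘ₗ E)

/-- The full normalizing groupoid
`{v ∈ N : v* v and v v* are projections of B, v B v* = B v v*}` of `B` in `N`. -/
def fullGroupoid (N B : Set (H →L[ℂ] H)) : Set (H →L[ℂ] H) :=
  {v | v ∈ N ∧ star v * v ∈ B ∧ IsStarProjection (star v * v) ∧
    v * star v ∈ B ∧ IsStarProjection (v * star v) ∧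
    (fun b => v * b * star v) '' B = (fun b => b * (v * star v)) '' B}

/-- `𝒢` is an `E`-groupoid for the inclusion `A ⊆ M` with conditional expectation `E`. -/
structure IsGroupoid (M A : VonNeumannAlgebra H) (E : (H →L[ℂ] H) →ₗ[ℂ] (H →L[ℂ] H))
    (𝒢 : Set (H →L[ℂ] H)) : Prop where
  subset_full : 𝒢 ⊆ fullGroupoid (M : Set (H →L[ℂ] H)) A
  mul_mem : ∀ u ∈ 𝒢, ∀ v ∈ 𝒢, u * v ∈ 𝒢
  star_mem : ∀ u ∈ 𝒢, star u ∈ 𝒢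
  /-- `𝒢` contains all partial isometries of `A`. -/
  partialIsometry_mem : ∀ u ∈ A, u * star u * u = u → u ∈ 𝒢
  /-- Strong-* sums of elements with orthogonal left supports and orthogonal right supports.
  (The partial sums are contractions, so strong-* and `σ`-strong-* convergence agree. Finite
  collections are padded with zeros.) -/
  sum_mem : ∀ (u : ℕ → H →L[ℂ] H) (s : H →L[ℂ] H), (∀ k, u k ∈ 𝒢) →
    (∀ j k, j ≠ k → (star (u j) * u j) * (star (u k) * u k) = 0) →
    (∀ j k, j ≠ k → (u j * star (u j)) * (u k * star (u k)) = 0) →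
    (∀ ξ, HasSum (fun k => u k ξ) (s ξ)) →
    (∀ ξ, HasSum (fun k => star (u k) ξ) (star s ξ)) → s ∈ 𝒢
  /-- `E u = e u` for a projection `e` of `A` with `e ≤ u u*`. -/
  exists_proj : ∀ u ∈ 𝒢, ∃ e ∈ A, IsStarProjection e ∧ e * (u * star u) = e ∧ E u = e * u
  equivariant : ∀ u ∈ 𝒢, ∀ x ∈ M, E (u * x * star u) = u * E x * star u

/-- A family `U`, indexed by an at most countable type, is a graphing of `𝒢`: it consists of
elements of `𝒢`, and `𝒢'' = B ∨ U''` as von Neumann algebras with unit `e`. -/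
def IsGraphing {ι : Type*} (e : H →L[ℂ] H) (B 𝒢 : Set (H →L[ℂ] H)) (U : ι → H →L[ℂ] H) : Prop :=
  Countable ι ∧ (∀ i, U i ∈ 𝒢) ∧ vnGen e 𝒢 = vnGen e (B ∪ Set.range U)

/-- The operator given by a word in the letters `U i` (coded `(i, true)`) and `(U i)*`
(coded `(i, false)`). -/
noncomputable def wordProd {ι : Type*} (U : ι → H →L[ℂ] H) (w : List (ι × Bool)) : H →L[ℂ] H :=
  (w.map fun l => if l.2 then U l.1 else star (U l.1)).prod

/-- A family `U`, indexed by an at most countable type, is a treeing (for `B ⊆ N` with conditional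
expectation `E`): it consists of elements of the full normalizing groupoid, and `E` vanishes on
all nonempty formally reduced words in `U ⊔ U*`. -/
def IsTreeing {ι : Type*} (N B : Set (H →L[ℂ] H)) (E : (H →L[ℂ] H) →ₗ[ℂ] (H →L[ℂ] H))
    (U : ι → H →L[ℂ] H) : Prop :=
  Countable ι ∧ (∀ i, U i ∈ fullGroupoid N B) ∧
    ∀ w : List (ι × Bool), w ≠ [] → FreeGroup.IsReduced w → E (wordProd U w) = 0

/-- The `τ`-cost `∑ τ(l(u) + r(u)) / 2` of a family `U`, where `l(u) = u u*`, `r(u) = u* u`. -/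
noncomputable def cost {ι : Type*} (τ : (H →L[ℂ] H) →ₗ[ℂ] ℂ) (U : ι → H →L[ℂ] H) : ENNReal :=
  ∑' i, ENNReal.ofReal ((τ (U i * star (U i) + star (U i) * U i)).re / 2)

/-- `z` is a projection in the center of `N`. -/
def IsCentralProj (N : Set (H →L[ℂ] H)) (z : H →L[ℂ] H) : Prop :=
  z ∈ N ∧ z ∈ Set.centralizer N ∧ IsStarProjection z

/-- `z` is the central support in `N` of the projection `p`: the smallest central projection of
`N` dominating `p`. -/
def IsCentralSupport (N : Set (H →L[ℂ] H)) (p z : H →L[ℂ] H) : Prop :=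
  IsCentralProj N z ∧ z * p = p ∧ ∀ z', IsCentralProj N z' → z' * p = p → z' * z = z

/-- `p` is an abelian projection of `N`: `p N p` is commutative. -/
def IsAbelianProj (N : Set (H →L[ℂ] H)) (p : H →L[ℂ] H) : Prop :=
  p ∈ N ∧ IsStarProjection p ∧
    ∀ x ∈ N, ∀ y ∈ N, (p * x * p) * (p * y * p) = (p * y * p) * (p * x * p)

/-- The set `p S p = {p x p : x ∈ S}`; for `S = A` commutative and `p ∈ A` this is `A p`. -/
def corner (p : H →L[ℂ] H) (S : Set (H →L[ℂ] H)) : Set (H →L[ℂ] H) :=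
  (fun x => p * x * p) '' S

end NormalizingGroupoid

/-! The treeing `U_v` is a spanning forest with roots in `p`, cut out of the graphing. Run through
the letters of `U ⊔ U*`, each occurring infinitely often, starting from `F 0 = p`. At stage `k` the
part of `g k * F k * (g k)*` outside `F k` is adjoined to `F k`, and `v k` is `(g k)*` restricted to
this increment; it maps the increment into `F k`. The projection left over by all `F k` commutes
with `A` and with every letter, so it is central in `M`. It is orthogonal to `p`, hence zero because
`p` has central support `1`. Take `U_v = (v k)`.

The paths `s_l` along the `v k` down to `p` (`descent`) have left supports under `p`, and their
right supports form a partition of unity (`isPartition_descent`). An operator is therefore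
determined by its blocks `s_m X s_n*`, which live in the corner of `p`; for `X` in `A` they lie in
`A` again. An operator `T` commuting with `A p` amplifies to `S = ∑ s_l* T s_l`, which commutes with
`A` and all `v k` (`exists_amplification`). Testing against commutants, this gives `p M_v p ⊆ A`,
hence (a), while the block decomposition gives (b).

For (c), a reduced word in the `v k` and in elements of the corner is zero unless it descends to
`p`, moves in the corner and ascends again. Equal outer letters are removed by equivariance of `E`;
in the remaining cases the supports are orthogonal, or the word lies in the corner.

For (d), each `v k` is a piece of one `U i` or of its adjoint, and the pieces of one `U i` have
orthogonal left supports. What remains, `f i * U i`, is cut into blocks `s_m (f i * U i) s_n*`;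
these form `U_h`. Cutting and transporting preserve total cost by normality and traciality of `τ`.
The right supports of the `v k` together with `p` partition `1`, so `U_v` costs `1 - τ p`. -/

namespace NormalizingGroupoid

variable {H : Type*} [NormedAddCommGroup H] [InnerProductSpace ℂ H] [CompleteSpace H]

/-! ### Partitions of unity by partial isometries -/

/-- A family of partial isometries whose right supports are mutually orthogonal and have no common
orthogonal complement. -/
structure IsPartition {ι : Type*} (s : ι → H →L[ℂ] H) : Prop where
  isometry : ∀ i, s i * star (s i) * s i = s i
  orthogonal : ∀ i j, i ≠ j → s i * star (s j) = 0
  total : ∀ X : H →L[ℂ] H, (∀ i, s i * X = 0) → X = 0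

namespace IsPartition

variable {ι : Type*} {s : ι → H →L[ℂ] H}

theorem eq_zero_of_mul_star (hs : IsPartition s) {X : H →L[ℂ] H} (h : ∀ i, X * star (s i) = 0) :
    X = 0 := by
  rw [← star_eq_zero]
  refine hs.total _ fun i => ?_
  rw [← star_star (s i), ← star_mul, h, star_zero]

theorem isStarProjection_sum (hs : IsPartition s) (F : Finset ι) :
    IsStarProjection (∑ i ∈ F, star (s i) * s i) := by
  classical
  induction F using Finset.induction_on with
  | empty => simp
  | insert a F ha ih =>
    rw [Finset.sum_insert ha]
    refine IsStarProjection.add ⟨?_, IsSelfAdjoint.star_mul_self _⟩ ih ?_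
    · rw [IsIdempotentElem, mul_assoc, ← mul_assoc (s a), hs.isometry]
    · rw [Finset.mul_sum]
      refine Finset.sum_eq_zero fun i hi => ?_
      rw [mul_assoc, ← mul_assoc (s a), hs.orthogonal a i (by rintro rfl; exact ha hi), zero_mul,
        mul_zero]

theorem sum_norm_sq_le (hs : IsPartition s) (F : Finset ι) (x : H) :
    ∑ i ∈ F, ‖s i x‖ ^ 2 ≤ ‖x‖ ^ 2 := by
  set D : H →L[ℂ] H := ∑ i ∈ F, star (s i) * s i with hD
  have hP := hs.isStarProjection_sum F
  have h1 : ((∑ i ∈ F, ‖s i x‖ ^ 2 : ℝ) : ℂ) = inner ℂ x (D x) := by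
    rw [hD, sum_apply, inner_sum]
    push_cast
    refine Finset.sum_congr rfl fun i _ => ?_
    rw [Function.comp_apply,
      ContinuousLinearMap.star_eq_adjoint, ContinuousLinearMap.adjoint_inner_right, inner_self_eq_norm_sq_to_K]
    rfl
  have h2 : ‖(inner ℂ x (D x) : ℂ)‖ ≤ ‖x‖ * (1 * ‖x‖) :=
    (norm_inner_le_norm _ _).trans
      (mul_le_mul_of_nonneg_left (D.le_of_opNorm_le (IsStarProjection.norm_le _ hP) x)
        (norm_nonneg _))
  rw [← h1, Complex.norm_real, Real.norm_of_nonneg (Finset.sum_nonneg fun i _ => by positivity)]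
    at h2
  linarith [h2, sq ‖x‖]

theorem inner_conj (hs : IsPartition s) {i j : ι} (hij : i ≠ j) (x y : H) :
    (inner ℂ (star (s i) x) (star (s j) y) : ℂ) = 0 := by
  rw [ContinuousLinearMap.star_eq_adjoint (s i), ContinuousLinearMap.adjoint_inner_left,
    ← mul_apply_eq_comp (F := H →L[ℂ] H), hs.orthogonal i j hij]
  simp

theorem norm_sum_sq (hs : IsPartition s) (F : Finset ι) (y : ι → H) :
    ‖∑ i ∈ F, star (s i) (y i)‖ ^ 2 = ∑ i ∈ F, ‖star (s i) (y i)‖ ^ 2 := by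
  classical
  have : ((‖∑ i ∈ F, star (s i) (y i)‖ ^ 2 : ℝ) : ℂ) =
      ((∑ i ∈ F, ‖star (s i) (y i)‖ ^ 2 : ℝ) : ℂ) := by
    push_cast
    have h := inner_self_eq_norm_sq_to_K (𝕜 := ℂ) (∑ i ∈ F, star (s i) (y i))
    rw [sum_inner] at h
    refine h.symm.trans (Finset.sum_congr rfl fun i hi => ?_)
    rw [inner_sum, Finset.sum_eq_single_of_mem i hi]
    · exact inner_self_eq_norm_sq_to_K _
    · intro j _ hj
      exact hs.inner_conj hj.symm _ _
  exact_mod_cast this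

theorem norm_star_le (hs : IsPartition s) (i : ι) : ‖star (s i)‖ ≤ 1 := by
  have h : IsStarProjection (star (s i) * s i) := by
    simpa using hs.isStarProjection_sum {i}
  have h1 := IsStarProjection.norm_le _ h
  rw [CStarRing.norm_star_mul_self] at h1
  rw [norm_star]
  nlinarith [norm_nonneg (s i)]

/-- The diagonal amplification of an operator along a partition. -/
theorem exists_hasSum_conj (hs : IsPartition s) (T : H →L[ℂ] H) :
    ∃ S : H →L[ℂ] H, ∀ x, HasSum (fun i => (star (s i) * T * s i) x) (S x) := by
  have hle : ∀ x i, ‖star (s i) (T (s i x))‖ ^ 2 ≤ ‖T‖ ^ 2 * ‖s i x‖ ^ 2 := by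
    intro x i
    rw [← mul_pow]
    refine pow_le_pow_left₀ (norm_nonneg _) ?_ 2
    refine ((star (s i)).le_of_opNorm_le (hs.norm_star_le i) _).trans ?_
    rw [one_mul]
    exact T.le_opNorm _
  have hbound : ∀ (F : Finset ι) x, ‖∑ i ∈ F, star (s i) (T (s i x))‖ ≤ ‖T‖ * ‖x‖ := by
    intro F x
    refine (sq_le_sq₀ (norm_nonneg _) (by positivity)).1 ?_
    rw [hs.norm_sum_sq F fun i => T (s i x), mul_pow]
    refine (Finset.sum_le_sum fun i _ => hle x i).trans ?_
    rw [← Finset.mul_sum]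
    exact mul_le_mul_of_nonneg_left (hs.sum_norm_sq_le F x) (by positivity)
  have hsum : ∀ x, Summable fun i => star (s i) (T (s i x)) := by
    intro x
    -- The summands lie in mutually orthogonal ranges, so convergence reduces to square summability
    -- of norms.
    have hfam : OrthogonalFamily ℂ (fun i => LinearMap.range (star (s i)).toLinearMap)
        fun i => (LinearMap.range (star (s i)).toLinearMap).subtypeₗᵢ := by
      rintro i j hij ⟨_, a, rfl⟩ ⟨_, b, rfl⟩
      exact hs.inner_conj hij a b
    refine (hfam.summable_iff_norm_sq_summable
      fun i => ⟨star (s i) (T (s i x)), LinearMap.mem_range_self _ _⟩).2 ?_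
    refine summable_of_sum_le (c := ‖T‖ ^ 2 * ‖x‖ ^ 2) (fun i => by positivity) fun F => ?_
    refine (Finset.sum_le_sum fun i _ => hle x i).trans ?_
    rw [← Finset.mul_sum]
    exact mul_le_mul_of_nonneg_left (hs.sum_norm_sq_le F x) (by positivity)
  refine ⟨LinearMap.mkContinuous
    { toFun := fun x => ∑' i, star (s i) (T (s i x))
      map_add' := fun x y => by
        simp only [map_add]
        exact (hsum x).tsum_add (hsum y)
      map_smul' := fun c x => by
        simp only [map_smul, RingHom.id_apply]
        exact (hsum x).tsum_const_smul c } ‖T‖ fun x =>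
          le_of_tendsto (hsum x).hasSum.norm (Filter.Eventually.of_forall fun F => hbound F x),
    fun x => (hsum x).hasSum⟩

theorem hasSum_mul (hs : IsPartition s) {T S : H →L[ℂ] H}
    (hS : ∀ x, HasSum (fun i => (star (s i) * T * s i) x) (S x)) (i : ι) :
    s i * S = s i * star (s i) * T * s i := by
  ext x
  have h := (hS x).mapL (s i)
  refine (h.unique (hasSum_single i ?_))
  intro j hj
  rw [← mul_apply_eq_comp (F := H →L[ℂ] H), ← mul_assoc, ← mul_assoc, hs.orthogonal i j hj.symm]
  simp

theorem hasSum_mul_star (hs : IsPartition s) {T S : H →L[ℂ] H}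
    (hS : ∀ x, HasSum (fun i => (star (s i) * T * s i) x) (S x)) (i : ι) :
    S * star (s i) = star (s i) * T * (s i * star (s i)) := by
  ext x
  refine ((hS (star (s i) x)).unique (hasSum_single i ?_))
  intro j hj
  rw [← mul_apply_eq_comp (F := H →L[ℂ] H), mul_assoc, hs.orthogonal j i hj]
  simp

/-- The amplification of `1` agrees with `1` after left multiplication by every `s i`, so `total`
identifies them. -/
theorem hasSum_one (hs : IsPartition s) (x : H) :
    HasSum (fun i => (star (s i) * s i) x) x := by
  obtain ⟨S, hS⟩ := hs.exists_hasSum_conj 1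
  have h : S = 1 := by
    rw [← sub_eq_zero]
    refine hs.total _ fun i => ?_
    rw [mul_sub, hs.hasSum_mul hS, mul_one, hs.isometry, mul_one, sub_self]
  simpa [h] using hS x

end IsPartition

/-! ### Bicommutant arguments -/

/-- Membership in a von Neumann algebra is tested by its commutant. -/
theorem mem_of_commutant (A : VonNeumannAlgebra H) {x : H →L[ℂ] H}
    (h : ∀ T : H →L[ℂ] H, (∀ a ∈ A, a * T = T * a) → (∀ a ∈ A, a * star T = star T * a) →
      T * x = x * T) : x ∈ A := by
  have : x ∈ Set.centralizer (Set.centralizer (A : Set (H →L[ℂ] H))) := by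
    intro T hT
    refine h T hT fun a ha => ?_
    have := congrArg star (hT (star a) (star_mem ha))
    simpa using this.symm
  rwa [A.centralizer_centralizer] at this

/-- The common kernel of the `c i` is invariant under the commutant of `A`, a self-adjoint set, so
its projection lies in the bicommutant. -/
theorem exists_kernel_projection {ι : Type*} (A : VonNeumannAlgebra H) {c : ι → H →L[ℂ] H}
    (hc : ∀ i, c i ∈ A) : ∃ f ∈ A, IsStarProjection f ∧ (∀ i, c i * f = 0) ∧
      ∀ X : H →L[ℂ] H, (∀ i, c i * X = 0) → f * X = X := by
  let K : Submodule ℂ H := ⨅ i, LinearMap.ker (c i).toLinearMap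
  have hK : ∀ x, x ∈ K ↔ ∀ i, c i x = 0 := fun x => by simp [K]
  have hcl : IsClosed (K : Set H) := by
    have : (K : Set H) = ⋂ i, {x | c i x = 0} := by ext x; simp [hK]
    rw [this]
    exact isClosed_iInter fun i => isClosed_eq (c i).continuous continuous_const
  have : CompleteSpace K := hcl.completeSpace_coe
  have h1 : ∀ i, c i * K.starProjection = 0 := fun i => by
    ext x
    exact (hK _).1 (Submodule.coe_mem (K.orthogonalProjectionOnto x)) i
  have h2 : ∀ X : H →L[ℂ] H, (∀ i, c i * X = 0) → K.starProjection * X = X := fun X hX => by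
    ext x
    refine Submodule.starProjection_eq_self_iff.2 ((hK _).2 fun i => ?_)
    exact congrArg (fun Y : H →L[ℂ] H => Y x) (hX i)
  have hp : IsStarProjection K.starProjection := isStarProjection_starProjection
  refine ⟨_, mem_of_commutant A fun T hT hT' => ?_, hp, h1, h2⟩
  have h3 : K.starProjection * (T * K.starProjection) = T * K.starProjection :=
    h2 _ fun i => by rw [← mul_assoc, hT _ (hc i), mul_assoc, h1, mul_zero]
  have h4 : K.starProjection * (star T * K.starProjection) = star T * K.starProjection :=
    h2 _ fun i => by rw [← mul_assoc, hT' _ (hc i), mul_assoc, h1, mul_zero]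
  have h5 := congrArg star h4
  simp only [star_mul, star_star, hp.isSelfAdjoint.star_eq] at h5
  rw [← h3, ← h5, mul_assoc]

theorem isClosed_coe (A : VonNeumannAlgebra H) : IsClosed (A : Set (H →L[ℂ] H)) := by
  rw [← A.centralizer_centralizer]
  exact Set.isClosed_centralizer _

/-- A groupoid is only known to contain the partial isometries of `A`. These suffice, since the
unitaries of a C*-algebra span it linearly. -/
theorem commute_of_commute_unitary (A : VonNeumannAlgebra H) {T p : H →L[ℂ] H}
    (h : ∀ u ∈ A, u * star u * u = u → T * (p * u * p) = p * u * p * T) {a : H →L[ℂ] H}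
    (ha : a ∈ A) : T * (p * a * p) = p * a * p * T := by
  have : IsClosed (A.toStarSubalgebra : Set (H →L[ℂ] H)) := isClosed_coe A
  have hs := CStarAlgebra.span_unitary A.toStarSubalgebra
  have hmem : (⟨a, ha⟩ : A.toStarSubalgebra) ∈
      Submodule.span ℂ (unitary A.toStarSubalgebra : Set A.toStarSubalgebra) := by
    rw [hs]; trivial
  have key : ∀ x ∈ Submodule.span ℂ (unitary A.toStarSubalgebra : Set A.toStarSubalgebra),
      T * (p * (x : H →L[ℂ] H) * p) = p * (x : H →L[ℂ] H) * p * T := by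
    intro x hx
    induction hx using Submodule.span_induction with
    | mem x hx =>
      refine h x x.2 ?_
      have := (Unitary.mem_iff.1 hx).2
      have h2 := congrArg (Subtype.val) this
      change (x : H →L[ℂ] H) * star (x : H →L[ℂ] H) = 1 at h2
      rw [h2, one_mul]
    | zero => simp
    | add x y _ _ hx hy => simp only [AddMemClass.coe_add, mul_add, add_mul, hx, hy]
    | smul c x _ hx =>
      simp only [SetLike.val_smul, mul_smul_comm, smul_mul_assoc, hx]
  exact key _ hmem

/-! ### Towers and their descents to the base -/

/-- An increasing sequence `F` of projections of `A`, starting at `p` and exhausting the unit, and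
partial isometries `v k` which map the increment `F (k + 1) - F k` into `F k` and normalize `A`. -/
structure IsTower (A : VonNeumannAlgebra H) (p : H →L[ℂ] H) (v F : ℕ → H →L[ℂ] H) : Prop where
  comm : ∀ a ∈ A, ∀ b ∈ A, a * b = b * a
  base : F 0 = p
  mem : ∀ k, F k ∈ A
  proj : ∀ k, IsStarProjection (F k)
  succ : ∀ k, F (k + 1) = F k + star (v k) * v k
  isometry : ∀ k, v k * star (v k) * v k = v k
  conj : ∀ k, ∀ a ∈ A, v k * a * star (v k) ∈ A
  conj_star : ∀ k, ∀ a ∈ A, star (v k) * a * v k ∈ A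
  range : ∀ k, F k * v k = v k
  source : ∀ k, v k * F k = 0
  total : ∀ X : H →L[ℂ] H, (∀ k, F k * X = 0) → X = 0

/-- The operators which follow the partial isometries `v` along a list of indices down to `p`. -/
def descent (p : H →L[ℂ] H) (v : ℕ → H →L[ℂ] H) : List ℕ → H →L[ℂ] H
  | [] => p
  | k :: l => descent p v l * v k

namespace IsTower

variable {A : VonNeumannAlgebra H} {p : H →L[ℂ] H} {v F : ℕ → H →L[ℂ] H}

theorem base_mem (h : IsTower A p v F) : p ∈ A := h.base ▸ h.mem 0

theorem base_proj (h : IsTower A p v F) : IsStarProjection p := h.base ▸ h.proj 0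

theorem star_mul_mem (h : IsTower A p v F) (k : ℕ) : star (v k) * v k ∈ A := by
  simpa using h.conj_star k 1 (one_mem A)

theorem mul_star_mem (h : IsTower A p v F) (k : ℕ) : v k * star (v k) ∈ A := by
  simpa using h.conj k 1 (one_mem A)

theorem mul_eq_of_le (h : IsTower A p v F) {a b : ℕ} (hab : a ≤ b) : F b * F a = F a := by
  induction b, hab using Nat.le_induction with
  | base => exact (h.proj a).isIdempotentElem
  | succ b _ ih =>
    have : v b * F a = 0 := by rw [← ih, ← mul_assoc, h.source, zero_mul]
    rw [h.succ, add_mul, ih, mul_assoc, this, mul_zero, add_zero]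

theorem mul_of_le (h : IsTower A p v F) {a b : ℕ} (hba : b ≤ a) : v a * F b = 0 := by
  rw [← h.mul_eq_of_le hba, ← mul_assoc, h.source, zero_mul]

theorem mul_of_lt (h : IsTower A p v F) {a b : ℕ} (hab : a < b) : v a * F b = v a := by
  have h1 : v a * F (a + 1) = v a := by
    rw [h.succ, mul_add, h.source, zero_add, ← mul_assoc, h.isometry]
  have h2 : F (a + 1) * F b = F (a + 1) := by
    rw [h.comm _ (h.mem _) _ (h.mem _), h.mul_eq_of_le hab]
  rw [← h1, mul_assoc, h2]

theorem mul_star_of_ne (h : IsTower A p v F) {a b : ℕ} (hab : a ≠ b) : v a * star (v b) = 0 := by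
  have key : ∀ a b, a < b → v a * star (v b) = 0 := fun a b hab => by
    rw [← h.mul_of_lt hab, mul_assoc, ← (h.proj b).isSelfAdjoint.star_eq, ← star_mul, h.source,
      star_zero, mul_zero]
  rcases hab.lt_or_gt with hab | hab
  · exact key a b hab
  · rw [← star_star (v a), ← star_mul, key b a hab, star_zero]

theorem base_mul_star (h : IsTower A p v F) (k : ℕ) : p * star (v k) = 0 := by
  rw [← h.base, ← (h.proj 0).isSelfAdjoint.star_eq, ← star_mul, h.mul_of_le (Nat.zero_le k),
    star_zero]

theorem descent_conj (h : IsTower A p v F) (l : List ℕ) {a : H →L[ℂ] H} (ha : a ∈ A) :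
    descent p v l * a * star (descent p v l) ∈ A := by
  induction l generalizing a with
  | nil =>
    rw [descent, h.base_proj.isSelfAdjoint.star_eq]
    exact mul_mem (mul_mem h.base_mem ha) h.base_mem
  | cons k l ih =>
    have := ih (h.conj k a ha)
    simpa only [descent, star_mul, mul_assoc] using this

theorem descent_star_conj (h : IsTower A p v F) (l : List ℕ) {a : H →L[ℂ] H} (ha : a ∈ A) :
    star (descent p v l) * a * descent p v l ∈ A := by
  induction l with
  | nil =>
    rw [descent, h.base_proj.isSelfAdjoint.star_eq]
    exact mul_mem (mul_mem h.base_mem ha) h.base_mem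
  | cons k l ih =>
    have := h.conj_star k _ ih
    simpa only [descent, star_mul, mul_assoc] using this

theorem descent_star_mul_mem (h : IsTower A p v F) (l : List ℕ) :
    star (descent p v l) * descent p v l ∈ A := by
  simpa using h.descent_star_conj l (one_mem A)

theorem descent_isometry (h : IsTower A p v F) (l : List ℕ) :
    descent p v l * star (descent p v l) * descent p v l = descent p v l := by
  induction l with
  | nil =>
    rw [descent, h.base_proj.isSelfAdjoint.star_eq, h.base_proj.isIdempotentElem.eq,
      h.base_proj.isIdempotentElem.eq]
  | cons k l ih =>
    calc descent p v l * v k * star (descent p v l * v k) * (descent p v l * v k)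
        = descent p v l * ((v k * star (v k)) * (star (descent p v l) * descent p v l)) * v k := by
          simp only [star_mul, mul_assoc]
      _ = (descent p v l * star (descent p v l) * descent p v l) *
            (v k * star (v k) * v k) := by
          rw [h.comm _ (h.mul_star_mem k) _ (h.descent_star_mul_mem l)]
          simp only [mul_assoc]
      _ = descent p v l * v k := by rw [ih, h.isometry]

theorem base_mul_descent (h : IsTower A p v F) (l : List ℕ) :
    p * descent p v l = descent p v l := by
  induction l with
  | nil => exact h.base_proj.isIdempotentElem
  | cons k l ih => rw [descent, ← mul_assoc, ih]

theorem descent_star_mul_base (h : IsTower A p v F) (l : List ℕ) :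
    star (descent p v l) * p = star (descent p v l) := by
  conv_rhs => rw [← h.base_mul_descent l, star_mul, h.base_proj.isSelfAdjoint.star_eq]

theorem descent_mul (h : IsTower A p v F) (l : List ℕ) {a : H →L[ℂ] H} (ha : a ∈ A) :
    descent p v l * a = descent p v l * a * star (descent p v l) * descent p v l := by
  conv_lhs => rw [← h.descent_isometry l]
  rw [mul_assoc, mul_assoc, ← mul_assoc (star _), h.comm _ (h.descent_star_mul_mem l) _ ha]
  simp only [mul_assoc]

/-- Paths with different first indices start in orthogonal increments. A common first index
contributes `v k * star (v k)`, an element of `A` that can be carried past the rest of the path, and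
induction applies. -/
theorem descent_mul_star_of_ne (h : IsTower A p v F) {m n : List ℕ} (hmn : m ≠ n) :
    descent p v m * star (descent p v n) = 0 := by
  induction m generalizing n with
  | nil =>
    cases n with
    | nil => exact absurd rfl hmn
    | cons k n => rw [descent, descent, star_mul, ← mul_assoc, h.base_mul_star, zero_mul]
  | cons k m ih =>
    cases n with
    | nil =>
      rw [descent, descent, mul_assoc, ← star_star (v k), ← star_mul, h.base_mul_star, star_zero,
        mul_zero]
    | cons j n =>
      rw [descent, descent, star_mul, mul_assoc, ← mul_assoc (v k)]
      by_cases hkj : k = j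
      · subst hkj
        rw [← mul_assoc, h.descent_mul m (h.mul_star_mem k), mul_assoc,
          ih fun hmn' => hmn (by rw [hmn']), mul_zero]
      · rw [h.mul_star_of_ne hkj, zero_mul, mul_zero]

theorem isPartition_descent (h : IsTower A p v F) : IsPartition (descent p v) where
  isometry := h.descent_isometry
  orthogonal _ _ hmn := h.descent_mul_star_of_ne hmn
  total X hX := by
    have key : ∀ k, ∀ X : H →L[ℂ] H, (∀ l, descent p v l * X = 0) → F k * X = 0 := by
      intro k
      induction k with
      | zero => exact fun X hX => by rw [h.base]; exact hX []
      | succ k ih =>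
        intro X hX
        -- The paths through `v k` are the paths applied to `v k * X`, which lies under `F k`; this
        -- is why the induction ranges over all `X`.
        have h1 : F k * (v k * X) = 0 := ih _ fun l => by
          rw [← mul_assoc]; exact hX (k :: l)
        rw [← mul_assoc, h.range] at h1
        rw [h.succ, add_mul, ih X hX, mul_assoc, h1, mul_zero, add_zero]
    exact h.total X fun k => key k X hX

/-- The coarser partition into `p` and the single increments; it computes the cost of `v`. -/
theorem isPartition_option (h : IsTower A p v F) :
    IsPartition (fun o : Option ℕ => o.elim p v) where
  isometry o := by
    cases o with
    | none => exact h.descent_isometry []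
    | some k => exact h.isometry k
  orthogonal o o' hoo' := by
    cases o with
    | none =>
      cases o' with
      | none => exact absurd rfl hoo'
      | some k => exact h.base_mul_star k
    | some k =>
      cases o' with
      | none =>
        change v k * star p = 0
        rw [← star_star (v k), ← star_mul, h.base_mul_star, star_zero]
      | some j => exact h.mul_star_of_ne fun hkj => hoo' (by rw [hkj])
  total X hX := by
    refine h.total X fun k => ?_
    induction k with
    | zero => rw [h.base]; exact hX none
    | succ k ih =>
      have h1 : v k * X = 0 := hX (some k)
      rw [h.succ, add_mul, ih, mul_assoc, h1, mul_zero, add_zero]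

/-- Off-diagonal blocks of `A` vanish and diagonal ones stay in `A` by normalization. Hence
commuting with `A p` is all that is needed to amplify an operator. -/
theorem descent_mul_mul_star_mem (h : IsTower A p v F) (m n : List ℕ) {a : H →L[ℂ] H}
    (ha : a ∈ A) : descent p v m * a * star (descent p v n) ∈ A := by
  by_cases hmn : m = n
  · subst hmn
    exact h.descent_conj m ha
  · rw [h.descent_mul m ha, mul_assoc, h.descent_mul_star_of_ne hmn, mul_zero]
    exact zero_mem A

theorem corner_descent (h : IsTower A p v F) (m n : List ℕ) (X : H →L[ℂ] H) :
    p * (descent p v m * X * star (descent p v n)) * p =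
      descent p v m * X * star (descent p v n) := by
  rw [mul_assoc, mul_assoc _ _ p, h.descent_star_mul_base, ← mul_assoc, ← mul_assoc,
    h.base_mul_descent]

theorem commute_descent (h : IsTower A p v F) {T : H →L[ℂ] H}
    (hT : ∀ a ∈ A, T * (p * a * p) = p * a * p * T) (m n : List ℕ) {a : H →L[ℂ] H} (ha : a ∈ A) :
    T * (descent p v m * a * star (descent p v n)) =
      descent p v m * a * star (descent p v n) * T := by
  have := hT _ (h.descent_mul_mul_star_mem m n ha)
  rwa [h.corner_descent] at this

/-- Extension of an operator commuting with `A p` along the tower. -/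
theorem exists_amplification (h : IsTower A p v F) {T : H →L[ℂ] H}
    (hT : ∀ a ∈ A, T * (p * a * p) = p * a * p * T) :
    ∃ S : H →L[ℂ] H, S * p = p * T ∧ p * S = T * p ∧
      (∀ X : H →L[ℂ] H, (∀ m n, T * (descent p v m * X * star (descent p v n)) =
        descent p v m * X * star (descent p v n) * T) → S * X = X * S) := by
  have hs := h.isPartition_descent
  -- `S = ∑ s_l* T s_l`. The empty path is `p` itself, so `S` agrees with `T` on the corner, and `X`
  -- commutes with `S` as soon as all blocks of `X` commute with `T`.
  obtain ⟨S, hS⟩ := hs.exists_hasSum_conj T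
  have hp := h.base_proj
  have hTp : T * p = p * T := by
    have := hT 1 (one_mem A)
    rwa [mul_one, hp.isIdempotentElem.eq] at this
  have hTs : ∀ m, T * (descent p v m * star (descent p v m)) =
      descent p v m * star (descent p v m) * T := fun m => by
    simpa using h.commute_descent hT m m (one_mem A)
  have h1 : ∀ m, descent p v m * S = T * descent p v m := fun m => by
    rw [hs.hasSum_mul hS, ← hTs, mul_assoc, hs.isometry]
  have h2 : ∀ m, S * star (descent p v m) = star (descent p v m) * T := fun m => by
    have := congrArg star (hs.isometry m)
    simp only [star_mul, star_star] at this
    rw [hs.hasSum_mul_star hS, mul_assoc, hTs, ← mul_assoc, this]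
  refine ⟨S, ?_, ?_, fun X hX => ?_⟩
  · simpa [descent, hp.isSelfAdjoint.star_eq] using h2 []
  · simpa [descent] using h1 []
  · rw [← sub_eq_zero]
    refine hs.total _ fun m => hs.eq_zero_of_mul_star fun n => ?_
    calc descent p v m * (S * X - X * S) * star (descent p v n)
        = descent p v m * S * X * star (descent p v n) -
            descent p v m * X * (S * star (descent p v n)) := by
          simp only [mul_sub, sub_mul, mul_assoc]
      _ = 0 := by
          rw [h1, h2, sub_eq_zero, ← mul_assoc _ _ T, ← hX m n]
          simp only [mul_assoc]

theorem commute_descent_apply (h : IsTower A p v F) {T : H →L[ℂ] H}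
    (hT : ∀ a ∈ A, T * (p * a * p) = p * a * p * T) (k : ℕ) (m n : List ℕ) :
    T * (descent p v m * v k * star (descent p v n)) =
      descent p v m * v k * star (descent p v n) * T := by
  have := h.commute_descent hT (k :: m) n (one_mem A)
  rwa [mul_one] at this

theorem commute_descent_star (h : IsTower A p v F) {T : H →L[ℂ] H}
    (hT : ∀ a ∈ A, T * (p * a * p) = p * a * p * T) (k : ℕ) (m n : List ℕ) :
    T * (descent p v m * star (v k) * star (descent p v n)) =
      descent p v m * star (v k) * star (descent p v n) * T := by
  have := h.commute_descent hT m (k :: n) (one_mem A)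
  rwa [mul_one, descent, star_mul, ← mul_assoc] at this

end IsTower

/-! ### Reduced words and the conditional expectation -/

/-- The operator given by a letter. -/
noncomputable def letter {ι : Type*} (U : ι → H →L[ℂ] H) (l : ι × Bool) : H →L[ℂ] H :=
  if l.2 then U l.1 else star (U l.1)

section Words

variable {ι : Type*} {U : ι → H →L[ℂ] H}

theorem wordProd_cons (l : ι × Bool) (w : List (ι × Bool)) :
    wordProd U (l :: w) = letter U l * wordProd U w := by
  simp [wordProd, letter]

theorem wordProd_nil : wordProd U [] = 1 := rfl

theorem wordProd_append (w w' : List (ι × Bool)) :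
    wordProd U (w ++ w') = wordProd U w * wordProd U w' := by
  simp [wordProd]

theorem letter_mem {M : VonNeumannAlgebra H} (h : ∀ i, U i ∈ M) (l : ι × Bool) :
    letter U l ∈ M := by
  unfold letter
  split_ifs
  exacts [h _, star_mem (h _)]

theorem wordProd_mem {M : VonNeumannAlgebra H} (h : ∀ i, U i ∈ M) (w : List (ι × Bool)) :
    wordProd U w ∈ M := by
  induction w with
  | nil => exact one_mem M
  | cons l w ih => rw [wordProd_cons]; exact mul_mem (letter_mem h l) ih

theorem wordProd_map {κ : Type*} (f : ι → κ) (V : κ → H →L[ℂ] H) (w : List (ι × Bool)) :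
    wordProd V (w.map (Prod.map f id)) = wordProd (V ∘ f) w := by
  simp [wordProd, Function.comp_def]

theorem isReduced_map {κ : Type*} {f : ι → κ} (hf : Function.Injective f) {w : List (ι × Bool)} :
    FreeGroup.IsReduced (w.map (Prod.map f id)) ↔ FreeGroup.IsReduced w := by
  simp [FreeGroup.IsReduced, List.isChain_map, hf.eq_iff]

theorem IsTreeing.comp_injective {κ : Type*} {N B : Set (H →L[ℂ] H)}
    {E : (H →L[ℂ] H) →ₗ[ℂ] (H →L[ℂ] H)} {V : κ → H →L[ℂ] H} (h : IsTreeing N B E V) {f : ι → κ}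
    (hf : Function.Injective f) : IsTreeing N B E (V ∘ f) := by
  obtain ⟨h1, h2, h3⟩ := h
  refine ⟨hf.countable, fun i => h2 _, fun w hw hr => ?_⟩
  rw [← wordProd_map]
  exact h3 _ (by simpa using hw) ((isReduced_map hf).2 hr)

end Words

/-- By the bimodule property and commutativity, `E (e x f) = E x * e * f`. -/
theorem IsCondExp.eq_zero_of_mul_eq_zero {M A : VonNeumannAlgebra H}
    {E : (H →L[ℂ] H) →ₗ[ℂ] (H →L[ℂ] H)} (hE : IsCondExp M A E)
    (hA : ∀ a ∈ A, ∀ b ∈ A, a * b = b * a) {e f x : H →L[ℂ] H} (he : e ∈ A) (hf : f ∈ A)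
    (hx : x ∈ M) (hef : e * f = 0) (h : e * x * f = x) : E x = 0 := by
  rw [← h, hE.bimodule e he f hf x hx, hA _ he _ (hE.map_mem x hx), mul_assoc, hef, mul_zero]

namespace IsTower

variable {A : VonNeumannAlgebra H} {p : H →L[ℂ] H} {v F : ℕ → H →L[ℂ] H}

theorem mul_base (h : IsTower A p v F) (k : ℕ) : v k * p = 0 := by
  rw [← h.base]; exact h.mul_of_le (Nat.zero_le k)

theorem mul_base_eq (h : IsTower A p v F) (k : ℕ) : F k * p = p := by
  rw [← h.base]; exact h.mul_eq_of_le (Nat.zero_le k)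

/-- A letter `v a` with `a < b` lands under `F a ≤ F b`, one with `a ≥ b` kills `F b`, and a corner
element lands under `p ≤ F b`. No letter that descends or stays in the corner can leave `F b`. -/
theorem range_mul (h : IsTower A p v F) {b : ℕ} {g X : H →L[ℂ] H}
    (hg : (∃ a, g = v a) ∨ p * g = g) (hX : F b * X = X) : F b * (g * X) = g * X := by
  rcases hg with ⟨a, rfl⟩ | hg
  · rcases lt_or_ge a b with hab | hab
    · rw [← h.range a, ← mul_assoc, ← mul_assoc, h.mul_eq_of_le hab.le]
    · rw [← hX, ← mul_assoc (v a), h.mul_of_le hab, zero_mul, mul_zero]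
  · rw [← hg, ← mul_assoc, ← mul_assoc, h.mul_base_eq]

theorem range_wordProd (h : IsTower A p v F) {ι : Type*} {W : ι → H →L[ℂ] H} {b : ℕ}
    {X : H →L[ℂ] H} (hX : F b * X = X) {w : List (ι × Bool)}
    (hw : ∀ l ∈ w, (∃ a, letter W l = v a) ∨ p * letter W l = letter W l) :
    F b * (wordProd W w * X) = wordProd W w * X := by
  induction w with
  | nil => rwa [wordProd_nil, one_mul]
  | cons l w ih =>
    rw [wordProd_cons, mul_assoc]
    exact h.range_mul (hw l (by simp)) (ih fun l hl => hw l (by simp [hl]))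

theorem source_wordProd (h : IsTower A p v F) {ι : Type*} {W : ι → H →L[ℂ] H} {b : ℕ}
    {w : List (ι × Bool)} {X : H →L[ℂ] H} (hX : X * F b = X)
    (hw : ∀ l ∈ w, (∃ a, letter W l = star (v a)) ∨ letter W l * p = letter W l) :
    X * wordProd W w * F b = X * wordProd W w := by
  induction w generalizing X with
  | nil => rwa [wordProd_nil, mul_one]
  | cons l w ih =>
    rw [wordProd_cons, ← mul_assoc]
    refine ih ?_ fun l hl => hw l (by simp [hl])
    have hX' := congrArg star hX
    rw [star_mul, (h.proj b).isSelfAdjoint.star_eq] at hX'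
    have := congrArg star (h.range_mul (g := star (letter W l)) ?_ hX')
    · simpa [(h.proj b).isSelfAdjoint.star_eq, mul_assoc] using this
    · rcases hw l (by simp) with ⟨a, ha⟩ | ha
      · exact Or.inl ⟨a, by rw [ha, star_star]⟩
      · right
        have := congrArg star ha
        rwa [star_mul, h.base_proj.isSelfAdjoint.star_eq] at this

variable {κ : Type*} {V : κ → H →L[ℂ] H}

theorem letter_mul_base (h : IsTower A p v F) (hVl : ∀ i, p * V i = V i)
    (hVr : ∀ i, V i * p = V i) (l : κ × Bool) :
    letter V l * p = letter V l ∧ p * letter V l = letter V l := by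
  have h1 := fun i => congrArg star (hVl i)
  have h2 := fun i => congrArg star (hVr i)
  simp only [star_mul, h.base_proj.isSelfAdjoint.star_eq] at h1 h2
  unfold letter
  split_ifs
  exacts [⟨hVr _, hVl _⟩, ⟨h1 _, h2 _⟩]

/-- A formally reduced word in the `v k` and in elements of the corner of `p` vanishes unless it
first descends to `p`, then stays in the corner, then ascends. -/
theorem reduced_word_shape (h : IsTower A p v F) (hVl : ∀ i, p * V i = V i)
    (hVr : ∀ i, V i * p = V i) (w : List ((ℕ ⊕ κ) × Bool)) (hw : FreeGroup.IsReduced w) :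
    wordProd (Sum.elim v V) w = 0 ∨ ∃ (xs : List ℕ) (z : List (κ × Bool)) (ys : List ℕ),
      w = xs.map (fun a => (Sum.inl a, false)) ++ z.map (Prod.map Sum.inr id) ++
        ys.map (fun a => (Sum.inl a, true)) := by
  induction w with
  | nil => exact Or.inr ⟨[], [], [], rfl⟩
  | cons l w ih =>
    rcases ih (hw.infix (List.suffix_cons l w).isInfix) with h0 | ⟨xs, z, ys, rfl⟩
    · exact Or.inl (by rw [wordProd_cons, h0, mul_zero])
    rcases l with ⟨a | i, b⟩
    · cases b with
      | false => exact Or.inr ⟨a :: xs, z, ys, rfl⟩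
      | true =>
        cases xs with
        | cons c xs =>
          left
          by_cases hac : a = c
          · subst hac
            simp [FreeGroup.IsReduced] at hw
          · simp only [List.map_cons, List.cons_append, wordProd_cons, ← mul_assoc]
            simp [letter, h.mul_star_of_ne hac]
        | nil =>
          cases z with
          | nil => exact Or.inr ⟨[], [], a :: ys, rfl⟩
          | cons c z =>
            left
            simp only [List.map_nil, List.nil_append, List.map_cons, List.cons_append,
              wordProd_cons, ← mul_assoc]
            have h1 : letter (Sum.elim v V) (Prod.map Sum.inr id c) = letter V c := rfl
            have h2 : letter (Sum.elim v V) (Sum.inl a, true) = v a := rfl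
            rw [h1, h2, ← (h.letter_mul_base hVl hVr c).2, ← mul_assoc, h.mul_base]
            simp
    · cases xs with
      | cons c xs =>
        left
        simp only [List.map_cons, List.cons_append, wordProd_cons, ← mul_assoc]
        have h1 : letter (Sum.elim v V) (Sum.inr i, b) = letter V (i, b) := rfl
        have h2 : letter (Sum.elim v V) (Sum.inl c, false) = star (v c) := rfl
        rw [h1, h2, ← (h.letter_mul_base hVl hVr _).1, mul_assoc _ p, h.base_mul_star]
        simp
      | nil => exact Or.inr ⟨[], (i, b) :: z, ys, rfl⟩

/-- Induction from the outside inwards, which is why `ys` is listed in reverse. Equal outer letters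
are stripped by equivariance, distinct ones have orthogonal sources. If letters `v` occur on one
side only, the outermost one has its source in an increment, while the other end of the word stays
under the corresponding `F`, orthogonal to that increment. With neither side present, `hV` applies.
-/
theorem condExp_word_eq_zero {M : VonNeumannAlgebra H} {E : (H →L[ℂ] H) →ₗ[ℂ] (H →L[ℂ] H)}
    (hE : IsCondExp M A E) (h : IsTower A p v F) (hvM : ∀ k, v k ∈ M) (hVM : ∀ i, V i ∈ M)
    (hvE : ∀ k, ∀ x ∈ M, E (star (v k) * x * v k) = star (v k) * E x * v k)
    (hVl : ∀ i, p * V i = V i) (hVr : ∀ i, V i * p = V i)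
    (hV : ∀ z : List (κ × Bool), z ≠ [] → FreeGroup.IsReduced z → E (wordProd V z) = 0)
    (xs : List ℕ) (z : List (κ × Bool)) (ys : List ℕ) (w : List ((ℕ ⊕ κ) × Bool))
    (hw : w = xs.map (fun a => (Sum.inl a, false)) ++ z.map (Prod.map Sum.inr id) ++
        (ys.map (fun a => (Sum.inl a, true))).reverse)
    (hne : w ≠ []) (hr : FreeGroup.IsReduced w) : E (wordProd (Sum.elim v V) w) = 0 := by
  have hWM : ∀ i, Sum.elim v V i ∈ M := by rintro (k | i); exacts [hvM k, hVM i]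
  have hvF : ∀ k, F k * (star (v k) * v k) = 0 := fun k => by
    rw [h.comm _ (h.mem k) _ (h.star_mul_mem k), mul_assoc, h.source, mul_zero]
  have hvF' : ∀ k, (star (v k) * v k) * F k = 0 := fun k => by
    rw [mul_assoc, h.source, mul_zero]
  have hviso : ∀ k, (star (v k) * v k) * star (v k) = star (v k) := fun k => by
    have := congrArg star (h.isometry k)
    simpa [mul_assoc] using this
  induction xs generalizing ys w with
  | nil =>
    cases ys with
    | nil =>
      simp only [List.map_nil, List.nil_append, List.reverse_nil, List.append_nil] at hw
      subst hw
      rw [wordProd_map]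
      exact hV z (by simpa using hne) ((isReduced_map Sum.inr_injective).1 hr)
    | cons b ys =>
      simp only [List.map_nil, List.nil_append, List.map_cons, List.reverse_cons,
        ← List.append_assoc] at hw
      refine hE.eq_zero_of_mul_eq_zero h.comm (h.mem b) (h.star_mul_mem b) (wordProd_mem hWM w)
        (hvF b) ?_
      rw [hw, wordProd_append, wordProd_cons, wordProd_nil, mul_one]
      change F b * (_ * v b) * _ = _ * v b
      rw [h.range_wordProd (h.range b), mul_assoc, ← mul_assoc (v b), h.isometry]
      intro l hl
      simp only [List.mem_append, List.mem_reverse, List.mem_map] at hl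
      rcases hl with ⟨c, -, rfl⟩ | ⟨a, -, rfl⟩
      · exact Or.inr (h.letter_mul_base hVl hVr c).2
      · exact Or.inl ⟨a, rfl⟩
  | cons a xs ih =>
    cases ys with
    | nil =>
      simp only [List.map_nil, List.map_cons, List.reverse_nil, List.append_nil,
        List.cons_append] at hw
      refine hE.eq_zero_of_mul_eq_zero h.comm (h.star_mul_mem a) (h.mem a) (wordProd_mem hWM w)
        (hvF' a) ?_
      rw [hw, wordProd_cons]
      change _ * (star (v a) * _) * _ = star (v a) * _
      rw [← mul_assoc, hviso]
      refine h.source_wordProd ?_ fun l hl => ?_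
      · have := congrArg star (h.range a)
        rwa [star_mul, (h.proj a).isSelfAdjoint.star_eq] at this
      simp only [List.mem_append, List.mem_map] at hl
      rcases hl with ⟨c, -, rfl⟩ | ⟨c, -, rfl⟩
      · exact Or.inl ⟨c, rfl⟩
      · exact Or.inr (h.letter_mul_base hVl hVr c).1
    | cons b ys =>
      simp only [List.map_cons, List.reverse_cons, List.cons_append, ← List.append_assoc] at hw
      set w' : List ((ℕ ⊕ κ) × Bool) :=
        xs.map (fun a => (Sum.inl a, false)) ++ z.map (Prod.map Sum.inr id) ++
          (ys.map (fun a => (Sum.inl a, true))).reverse with hw'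
      have hprod : wordProd (Sum.elim v V) w =
          star (v a) * wordProd (Sum.elim v V) w' * v b := by
        rw [hw, wordProd_cons, wordProd_append, wordProd_cons, wordProd_nil, mul_one, ← mul_assoc]
        rfl
      have hM := wordProd_mem hWM w'
      by_cases hab : a = b
      · subst hab
        -- The inner word is nonempty: otherwise the word would be `star (v a) * v a`, which is not
        -- reduced.
        rw [hprod, hvE a _ hM, ih ys w' hw' ?_ (hr.infix ?_), mul_zero, zero_mul]
        · intro h0
          rw [hw, h0] at hr
          simp [FreeGroup.IsReduced] at hr
        · rw [hw]
          exact ⟨[(Sum.inl a, false)], [(Sum.inl a, true)], by simp⟩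
      · refine hE.eq_zero_of_mul_eq_zero h.comm (h.star_mul_mem a) (h.star_mul_mem b)
          (wordProd_mem hWM w) ?_ ?_
        · rw [mul_assoc, ← mul_assoc (v a), h.mul_star_of_ne hab, zero_mul, mul_zero]
        · rw [hprod]
          calc star (v a) * v a * (star (v a) * wordProd (Sum.elim v V) w' * v b) *
                (star (v b) * v b)
              = (star (v a) * v a * star (v a)) * wordProd (Sum.elim v V) w' *
                (v b * star (v b) * v b) := by simp only [mul_assoc]
            _ = _ := by rw [hviso, h.isometry]

theorem condExp_reduced_word_eq_zero {M : VonNeumannAlgebra H}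
    {E : (H →L[ℂ] H) →ₗ[ℂ] (H →L[ℂ] H)}
    (hE : IsCondExp M A E) (h : IsTower A p v F) (hvM : ∀ k, v k ∈ M) (hVM : ∀ i, V i ∈ M)
    (hvE : ∀ k, ∀ x ∈ M, E (star (v k) * x * v k) = star (v k) * E x * v k)
    (hVl : ∀ i, p * V i = V i) (hVr : ∀ i, V i * p = V i)
    (hV : ∀ z : List (κ × Bool), z ≠ [] → FreeGroup.IsReduced z → E (wordProd V z) = 0)
    (w : List ((ℕ ⊕ κ) × Bool)) (hne : w ≠ []) (hr : FreeGroup.IsReduced w) :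
    E (wordProd (Sum.elim v V) w) = 0 := by
  rcases h.reduced_word_shape hVl hVr w hr with h0 | ⟨xs, z, ys, hw⟩
  · rw [h0, map_zero]
  · exact h.condExp_word_eq_zero hE hvM hVM hvE hVl hVr hV xs z ys.reverse w
      (by simpa using hw) hne hr

end IsTower

/-! ### Elements of an `E`-groupoid -/

theorem isometry_of_isStarProjection {u : H →L[ℂ] H} (hu : IsStarProjection (star u * u)) :
    u * star u * u = u := by
  rw [← sub_eq_zero, ← CStarRing.star_mul_self_eq_zero_iff]
  have h := hu.isIdempotentElem.eq
  have h' : star u * u * (star u * u * (star u * u)) = star u * u := by rw [h, h]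
  simp only [star_sub, star_mul, star_star, sub_mul, mul_sub, mul_assoc] at h h' ⊢
  rw [h', h]
  simp

theorem isStarProjection_of_isometry {u : H →L[ℂ] H} (hu : u * star u * u = u) :
    IsStarProjection (star u * u) where
  isIdempotentElem := by rw [IsIdempotentElem, mul_assoc, ← mul_assoc u, hu]
  isSelfAdjoint := IsSelfAdjoint.star_mul_self u

theorem star_isometry {u : H →L[ℂ] H} (hu : u * star u * u = u) :
    star u * star (star u) * star u = star u := by
  have := congrArg star hu
  simpa [mul_assoc] using this

namespace IsGroupoid

variable {M A : VonNeumannAlgebra H} {E : (H →L[ℂ] H) →ₗ[ℂ] (H →L[ℂ] H)}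
  {𝒢 : Set (H →L[ℂ] H)}

theorem mem_alg (h : IsGroupoid M A E 𝒢) {u : H →L[ℂ] H} (hu : u ∈ 𝒢) : u ∈ M :=
  (h.subset_full hu).1

theorem isometry (h : IsGroupoid M A E 𝒢) {u : H →L[ℂ] H} (hu : u ∈ 𝒢) : u * star u * u = u :=
  isometry_of_isStarProjection (h.subset_full hu).2.2.1

theorem star_mul_mem (h : IsGroupoid M A E 𝒢) {u : H →L[ℂ] H} (hu : u ∈ 𝒢) : star u * u ∈ A :=
  (h.subset_full hu).2.1

theorem mul_star_mem (h : IsGroupoid M A E 𝒢) {u : H →L[ℂ] H} (hu : u ∈ 𝒢) : u * star u ∈ A :=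
  (h.subset_full hu).2.2.2.1

theorem conj_mem (h : IsGroupoid M A E 𝒢) {u a : H →L[ℂ] H} (hu : u ∈ 𝒢) (ha : a ∈ A) :
    u * a * star u ∈ A := by
  have h1 : u * a * star u ∈ (fun b => u * b * star u) '' (A : Set (H →L[ℂ] H)) := ⟨a, ha, rfl⟩
  rw [(h.subset_full hu).2.2.2.2.2] at h1
  obtain ⟨b, hb, hb'⟩ := h1
  rw [← hb']
  exact MulMemClass.mul_mem (show b ∈ A from hb) (h.mul_star_mem hu)

theorem proj_mem (h : IsGroupoid M A E 𝒢) {e : H →L[ℂ] H} (he : e ∈ A) (hp : IsStarProjection e) :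
    e ∈ 𝒢 :=
  h.partialIsometry_mem e he (by
    rw [hp.isSelfAdjoint.star_eq, hp.isIdempotentElem.eq, hp.isIdempotentElem.eq])

theorem letter_mem (h : IsGroupoid M A E 𝒢) {ι : Type*} {U : ι → H →L[ℂ] H} (hU : ∀ i, U i ∈ 𝒢)
    (l : ι × Bool) : letter U l ∈ 𝒢 := by
  unfold letter
  split_ifs
  exacts [hU _, h.star_mem _ (hU _)]

/-- An element of the groupoid under the projection `p` normalizes the corner. -/
theorem mem_fullGroupoid_corner (h : IsGroupoid M A E 𝒢)
    (hA : ∀ a ∈ A, ∀ b ∈ A, a * b = b * a) {p u : H →L[ℂ] H} (hpA : p ∈ A)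
    (hp : IsStarProjection p) (hu : u ∈ 𝒢) (hl : p * u = u) (hr : u * p = u) :
    u ∈ fullGroupoid (corner p (M : Set (H →L[ℂ] H))) (corner p A) := by
  obtain ⟨h1, h2, h3, h4, h5, h6⟩ := h.subset_full hu
  have hl' : star u * p = star u := by
    have := congrArg star hl
    rwa [star_mul, hp.isSelfAdjoint.star_eq] at this
  have hr' : p * star u = star u := by
    have := congrArg star hr
    rwa [star_mul, hp.isSelfAdjoint.star_eq] at this
  refine ⟨⟨u, h1, by simp only [hl, hr]⟩,
    ⟨_, h2, by simp only [mul_assoc, hr]; rw [← mul_assoc, hr']⟩, h3,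
    ⟨_, h4, by simp only [mul_assoc, hl']; rw [← mul_assoc, hl]⟩, h5, ?_⟩
  have e1 : (fun b => u * b * star u) '' (corner p (A : Set (H →L[ℂ] H))) =
      (fun b => u * b * star u) '' (A : Set (H →L[ℂ] H)) := by
    rw [corner, Set.image_image]
    refine Set.image_congr fun b _ => ?_
    calc u * (p * b * p) * star u = (u * p) * b * (p * star u) := by simp only [mul_assoc]
      _ = _ := by rw [hr, hr']
  have e2 : (fun b => b * (u * star u)) '' (corner p (A : Set (H →L[ℂ] H))) =
      (fun b => b * (u * star u)) '' (A : Set (H →L[ℂ] H)) := by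
    rw [corner, Set.image_image]
    refine Set.image_congr fun b hb => ?_
    calc p * b * p * (u * star u) = b * (p * (p * u) * star u) := by
          rw [hA p hpA b hb]; simp only [mul_assoc]
      _ = _ := by rw [hl, hl]
  rw [e1, e2, h6]

end IsGroupoid

/-! ### Construction of the tower from a sequence of letters -/

/-- The increasing sequence of projections obtained from `p` by adjoining successively the left
supports of `g k * F k`. -/
noncomputable def climb (p : H →L[ℂ] H) (g : ℕ → H →L[ℂ] H) : ℕ → H →L[ℂ] H
  | 0 => p
  | k + 1 => climb p g k + (1 - climb p g k) * (g k * climb p g k * star (g k))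

/-- The part of `(g k)*` which maps the increment of `climb p g` at `k` into `climb p g k`. -/
noncomputable def stepDown (p : H →L[ℂ] H) (g : ℕ → H →L[ℂ] H) (k : ℕ) : H →L[ℂ] H :=
  star (g k) * ((1 - climb p g k) * (g k * climb p g k * star (g k)))

section Climb

variable {M A : VonNeumannAlgebra H} {E : (H →L[ℂ] H) →ₗ[ℂ] (H →L[ℂ] H)}
  {𝒢 : Set (H →L[ℂ] H)} {p : H →L[ℂ] H} {g : ℕ → H →L[ℂ] H}

theorem isStarProjection_conj (h𝒢 : IsGroupoid M A E 𝒢) (hA : ∀ a ∈ A, ∀ b ∈ A, a * b = b * a)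
    {u f : H →L[ℂ] H} (hu : u ∈ 𝒢) (hfA : f ∈ A) (hf : IsStarProjection f) :
    IsStarProjection (u * f * star u) where
  isIdempotentElem := by
    have h1 := h𝒢.isometry hu
    calc u * f * star u * (u * f * star u) = u * (f * (star u * u)) * f * star u := by
          simp only [mul_assoc]
      _ = (u * star u * u) * (f * f) * star u := by
          rw [hA f hfA _ (h𝒢.star_mul_mem hu)]; simp only [mul_assoc]
      _ = u * f * star u := by rw [h1, hf.isIdempotentElem.eq]
  isSelfAdjoint := by
    rw [IsSelfAdjoint, star_mul, star_mul, star_star, hf.isSelfAdjoint.star_eq, mul_assoc]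

theorem climb_spec (h𝒢 : IsGroupoid M A E 𝒢) (hA : ∀ a ∈ A, ∀ b ∈ A, a * b = b * a)
    (hpA : p ∈ A) (hp : IsStarProjection p) (hg : ∀ k, g k ∈ 𝒢) (k : ℕ) :
    climb p g k ∈ A ∧ IsStarProjection (climb p g k) := by
  induction k with
  | zero => exact ⟨hpA, hp⟩
  | succ k ih =>
    obtain ⟨h1, h2⟩ := ih
    have hY := h𝒢.conj_mem (hg k) h1
    have hYp := isStarProjection_conj h𝒢 hA (hg k) h1 h2
    have hF : 1 - climb p g k ∈ A := sub_mem (one_mem A) h1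
    refine ⟨add_mem h1 (mul_mem hF hY), h2.add (h2.one_sub.mul hYp (hA _ hF _ hY)) ?_⟩
    rw [← mul_assoc, h2.mul_one_sub_self, zero_mul]

theorem increment_spec (h𝒢 : IsGroupoid M A E 𝒢) (hA : ∀ a ∈ A, ∀ b ∈ A, a * b = b * a)
    (hpA : p ∈ A) (hp : IsStarProjection p) (hg : ∀ k, g k ∈ 𝒢) (k : ℕ) :
    (1 - climb p g k) * (g k * climb p g k * star (g k)) ∈ A ∧
    IsStarProjection ((1 - climb p g k) * (g k * climb p g k * star (g k))) ∧
    g k * star (g k) * ((1 - climb p g k) * (g k * climb p g k * star (g k))) =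
      (1 - climb p g k) * (g k * climb p g k * star (g k)) := by
  obtain ⟨h1, h2⟩ := climb_spec h𝒢 hA hpA hp hg k
  have hY := h𝒢.conj_mem (hg k) h1
  have hYp := isStarProjection_conj h𝒢 hA (hg k) h1 h2
  have hF : 1 - climb p g k ∈ A := sub_mem (one_mem A) h1
  refine ⟨mul_mem hF hY, h2.one_sub.mul hYp (hA _ hF _ hY), ?_⟩
  rw [hA _ hF _ hY]
  simp only [← mul_assoc]
  rw [h𝒢.isometry (hg k)]

theorem stepDown_mem (h𝒢 : IsGroupoid M A E 𝒢) (hA : ∀ a ∈ A, ∀ b ∈ A, a * b = b * a)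
    (hpA : p ∈ A) (hp : IsStarProjection p) (hg : ∀ k, g k ∈ 𝒢) (k : ℕ) :
    stepDown p g k ∈ 𝒢 := by
  obtain ⟨h1, h2, -⟩ := increment_spec h𝒢 hA hpA hp hg k
  exact h𝒢.mul_mem _ (h𝒢.star_mem _ (hg k)) _ (h𝒢.proj_mem h1 h2)

theorem star_stepDown_mul (h𝒢 : IsGroupoid M A E 𝒢) (hA : ∀ a ∈ A, ∀ b ∈ A, a * b = b * a)
    (hpA : p ∈ A) (hp : IsStarProjection p) (hg : ∀ k, g k ∈ 𝒢) (k : ℕ) :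
    star (stepDown p g k) * stepDown p g k =
      (1 - climb p g k) * (g k * climb p g k * star (g k)) := by
  obtain ⟨-, h2, h3⟩ := increment_spec h𝒢 hA hpA hp hg k
  rw [stepDown, star_mul, star_star, h2.isSelfAdjoint.star_eq, mul_assoc, ← mul_assoc (g k) (star _),
    h3, h2.isIdempotentElem.eq]

/-- Let `f` be the projection onto the common kernel of the `F k`. Since each letter recurs
arbitrarily late, `F (n + 1)` absorbs `g n * F n * star (g n)` along a cofinal set of `n`, so `star
(g k)` maps the range of `f` into itself. Letters come with their adjoints, so `f` commutes with
them all and is central in `M`. -/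
theorem climb_total (h𝒢 : IsGroupoid M A E 𝒢) (hAM : ∀ x ∈ A, x ∈ M)
    (hA : ∀ a ∈ A, ∀ b ∈ A, a * b = b * a)
    (hpA : p ∈ A) (hp : IsStarProjection p) (hg : ∀ k, g k ∈ 𝒢)
    (hpM : IsCentralSupport (M : Set (H →L[ℂ] H)) p 1)
    (hrec : ∀ k N, ∃ m, N ≤ m ∧ g m = g k) (hstar : ∀ k, ∃ m, g m = star (g k))
    (hgen : ∀ T : H →L[ℂ] H, (∀ a ∈ A, a * T = T * a) → (∀ k, g k * T = T * g k) →
      ∀ x ∈ M, x * T = T * x)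
    (hmono : ∀ a b, a ≤ b → climb p g b * climb p g a = climb p g a)
    (X : H →L[ℂ] H) (hX : ∀ k, climb p g k * X = 0) : X = 0 := by
  have hF := climb_spec h𝒢 hA hpA hp hg
  obtain ⟨f, hfA, hf, hcf, hfX⟩ := exists_kernel_projection A fun k => (hF k).1
  have key : ∀ k, f * (star (g k) * f) = star (g k) * f := by
    refine fun k => hfX _ fun m => ?_
    obtain ⟨n, hmn, hn⟩ := hrec k m
    have hY := h𝒢.conj_mem (hg n) (hF n).1
    have hYp := isStarProjection_conj h𝒢 hA (hg n) (hF n).1 (hF n).2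
    have h1 : climb p g (n + 1) * (g n * climb p g n * star (g n)) =
        g n * climb p g n * star (g n) := by
      rw [climb, add_mul, mul_assoc (1 - _), hYp.isIdempotentElem.eq, ← add_mul]
      simp
    have h2 : g n * climb p g n * star (g n) * f = 0 := by
      rw [← h1, hA _ (hF _).1 _ hY, mul_assoc, hcf, mul_zero]
    have h3 : climb p g n * star (g n) = star (g n) * (g n * climb p g n * star (g n)) := by
      conv_lhs => rw [← star_isometry (h𝒢.isometry (hg n)), star_star]
      rw [← mul_assoc, hA _ (hF n).1 _ (h𝒢.star_mul_mem (hg n))]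
      simp only [mul_assoc]
    rw [← hmono m n hmn, hA _ (hF n).1 _ (hF m).1, ← hn, mul_assoc, ← mul_assoc (climb p g n), h3,
      mul_assoc, h2, mul_zero, mul_zero]
  have hcomm : ∀ k, g k * f = f * g k := by
    intro k
    obtain ⟨m, hm⟩ := hstar k
    have h1 := key m
    rw [hm, star_star] at h1
    have h2 := congrArg star (key k)
    simp only [star_mul, star_star, hf.isSelfAdjoint.star_eq] at h2
    rw [← h1, ← mul_assoc, h2]
  have hfM := hgen f (fun a ha => hA a ha f hfA) hcomm
  -- The central projection `1 - f` dominates `p`, because `f` is orthogonal to `F 0 = p`; hence it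
  -- equals `1`.
  have hz := hpM.2.2 (1 - f) ⟨sub_mem (one_mem M) (hAM f hfA), fun x hx => by
    rw [mul_sub, sub_mul, mul_one, one_mul, hfM x hx], hf.one_sub⟩ (by
      rw [sub_mul, one_mul, hA f hfA p hpA]
      have := hcf 0
      rw [climb] at this
      rw [this, sub_zero])
  have hf0 : f = 0 := by simpa using hz
  rw [← hfX X hX, hf0, zero_mul]

theorem isTower_climb (h𝒢 : IsGroupoid M A E 𝒢) (hAM : ∀ x ∈ A, x ∈ M)
    (hA : ∀ a ∈ A, ∀ b ∈ A, a * b = b * a)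
    (hpA : p ∈ A) (hp : IsStarProjection p) (hg : ∀ k, g k ∈ 𝒢)
    (hpM : IsCentralSupport (M : Set (H →L[ℂ] H)) p 1)
    (hrec : ∀ k N, ∃ m, N ≤ m ∧ g m = g k) (hstar : ∀ k, ∃ m, g m = star (g k))
    (hgen : ∀ T : H →L[ℂ] H, (∀ a ∈ A, a * T = T * a) → (∀ k, g k * T = T * g k) →
      ∀ x ∈ M, x * T = T * x) :
    IsTower A p (stepDown p g) (climb p g) := by
  have hF := climb_spec h𝒢 hA hpA hp hg
  have hq := increment_spec h𝒢 hA hpA hp hg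
  have hv := stepDown_mem h𝒢 hA hpA hp hg
  have hsucc : ∀ k, climb p g (k + 1) =
      climb p g k + star (stepDown p g k) * stepDown p g k := fun k => by
    rw [star_stepDown_mul h𝒢 hA hpA hp hg, climb]
  have hsource : ∀ k, stepDown p g k * climb p g k = 0 := fun k => by
    rw [stepDown, mul_assoc, hA _ (hq k).1 _ (hF k).1, ← mul_assoc (climb p g k),
      (hF k).2.mul_one_sub_self, zero_mul, mul_zero]
  refine ⟨hA, rfl, fun k => (hF k).1, fun k => (hF k).2, hsucc, fun k => h𝒢.isometry (hv k),
    fun k a ha => h𝒢.conj_mem (hv k) ha, fun k a ha => ?_, fun k => ?_, hsource,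
    climb_total h𝒢 hAM hA hpA hp hg hpM hrec hstar hgen fun a b hab => ?_⟩
  · have := h𝒢.conj_mem (h𝒢.star_mem _ (hv k)) ha
    rwa [star_star] at this
  · have hY := h𝒢.conj_mem (hg k) (hF k).1
    have hF1 : 1 - climb p g k ∈ A := sub_mem (one_mem A) (hF k).1
    rw [stepDown, hA _ hF1 _ hY]
    have h1 : climb p g k * (star (g k) * (g k * climb p g k * star (g k))) =
        star (g k) * (g k * climb p g k * star (g k)) := by
      calc climb p g k * (star (g k) * (g k * climb p g k * star (g k)))
          = climb p g k * (star (g k) * g k) * climb p g k * star (g k) := by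
            simp only [mul_assoc]
        _ = star (g k) * g k * (climb p g k * climb p g k) * star (g k) := by
            rw [hA _ (hF k).1 _ (h𝒢.star_mul_mem (hg k))]; simp only [mul_assoc]
        _ = _ := by rw [(hF k).2.isIdempotentElem.eq]; simp only [mul_assoc]
    rw [← mul_assoc (star (g k)), ← mul_assoc, h1]
  · induction b, hab using Nat.le_induction with
    | base => exact (hF a).2.isIdempotentElem
    | succ b _ ih =>
      have : stepDown p g b * climb p g a = 0 := by rw [← ih, ← mul_assoc, hsource, zero_mul]
      rw [hsucc, add_mul, ih, mul_assoc, this, mul_zero, add_zero]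

end Climb

/-! ### Cutting a graphing into pieces of the tower and remainders -/

section Pieces

variable {A : VonNeumannAlgebra H} {p : H →L[ℂ] H} {v F U : ℕ → H →L[ℂ] H} {L : ℕ → ℕ × Bool}

/-- Left support of the piece of `U i` which is used, in one of the two directions, by `v k`. -/
noncomputable def piece (v : ℕ → H →L[ℂ] H) (L : ℕ → ℕ × Bool) (i k : ℕ) : H →L[ℂ] H :=
  if (L k).1 = i then (if (L k).2 then star (v k) * v k else v k * star (v k)) else 0

theorem piece_mem (h : IsTower A p v F) (i k : ℕ) : piece v L i k ∈ A := by
  unfold piece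
  split_ifs
  exacts [h.star_mul_mem k, h.mul_star_mem k, zero_mem A]

theorem isStarProjection_piece (h : IsTower A p v F) (i k : ℕ) :
    IsStarProjection (piece v L i k) := by
  unfold piece
  split_ifs
  · exact isStarProjection_of_isometry (h.isometry k)
  · simpa using isStarProjection_of_isometry (star_isometry (h.isometry k))
  · exact IsStarProjection.zero _

theorem IsTower.mul_of_ge (h : IsTower A p v F) {a b : ℕ} (hab : a ≤ b) : v b * v a = 0 := by
  rw [← h.range a, ← mul_assoc, h.mul_of_le hab, zero_mul]

theorem eq_mul_of_letter (hv : ∀ k, v k = star (letter U (L k)) * (star (v k) * v k)) {i k : ℕ}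
    (hi : (L k).1 = i) (hb : (L k).2 = false) : v k = U i * (star (v k) * v k) := by
  have := hv k
  simpa [letter, hb, hi] using this

theorem star_eq_mul_of_letter (hv : ∀ k, v k = star (letter U (L k)) * (star (v k) * v k))
    {i k : ℕ} (hi : (L k).1 = i) (hb : (L k).2 = true) : star (v k) = star (v k) * v k * U i := by
  have := congrArg star (hv k)
  simpa [letter, hb, hi] using this

/-- Two increments are orthogonal, and `U i` carries orthogonal projections of `A` to orthogonal
ones; this settles equal directions. For opposite directions with `k < m`, both `v k` and increment
`k` involve only positions under `F (k + 1)`, hence `v m * v k = 0`, and the relations with `U i`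
reduce the product to this. -/
theorem piece_mul_piece (h : IsTower A p v F)
    (hUA : ∀ i, star (U i) * U i ∈ A)
    (hv : ∀ k, v k = star (letter U (L k)) * (star (v k) * v k)) (i : ℕ) {k m : ℕ} (hkm : k ≠ m) :
    piece v L i k * piece v L i m = 0 := by
  have key : ∀ k m, k < m → piece v L i k * piece v L i m = 0 := by
    intro k m hkm
    have hz : star (v k) * star (v m) = 0 := by rw [← star_mul, h.mul_of_ge hkm.le, star_zero]
    have hq : star (v k) * v k * (star (v m) * v m) = 0 := by
      rw [mul_assoc, ← mul_assoc (v k), h.mul_star_of_ne hkm.ne, zero_mul, mul_zero]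
    by_cases hk : (L k).1 = i
    swap
    · simp [piece, hk]
    by_cases hm : (L m).1 = i
    swap
    · simp [piece, hm]
    cases hbk : (L k).2 <;> cases hbm : (L m).2 <;> simp only [piece, hk, hm, hbk, hbm, if_true,
      Bool.false_eq_true, if_false]
    · have h1 := eq_mul_of_letter hv hk hbk
      have h2 := eq_mul_of_letter hv hm hbm
      have h3 : star (v k) * v m = 0 := by
        calc star (v k) * v m
            = star (U i * (star (v k) * v k)) * (U i * (star (v m) * v m)) := by rw [← h1, ← h2]
          _ = star (v k) * v k * (star (U i) * U i) * (star (v m) * v m) := by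
              simp only [star_mul, star_star, mul_assoc]
          _ = 0 := by
              rw [h.comm _ (h.star_mul_mem k) _ (hUA i), mul_assoc, hq, mul_zero]
      rw [mul_assoc, ← mul_assoc (star (v k)), h3, zero_mul, mul_zero]
    · rw [mul_assoc, ← mul_assoc (star (v k)), hz, zero_mul, mul_zero]
    · have h1 := star_eq_mul_of_letter hv hk hbk
      have h2 := eq_mul_of_letter hv hm hbm
      calc star (v k) * v k * (v m * star (v m))
          = star (v k) * v k * (U i * (star (v m) * v m) * star (v m)) := by rw [← h2]
        _ = star (v k) * v k * U i * (star (v m) * v m * star (v m)) := by simp only [mul_assoc]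
        _ = star (v k) * star (v m) * v m * star (v m) := by
            rw [← h1]; simp only [mul_assoc]
        _ = 0 := by rw [hz, zero_mul, zero_mul]
    · exact hq
  rcases hkm.lt_or_gt with hkm | hkm
  · exact key k m hkm
  · rw [h.comm _ (piece_mem h i k) _ (piece_mem h i m), key m k hkm]

/-- Since `v k` is cut from the adjoint of its letter, the piece of `U i` returned is `star (v k)`
when the letter is `U i` and `v k` when it is `star (U i)`. -/
theorem piece_mul (h : IsTower A p v F) (hUA : ∀ i, star (U i) * U i ∈ A)
    (hUi : ∀ i, U i * star (U i) * U i = U i)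
    (hv : ∀ k, v k = star (letter U (L k)) * (star (v k) * v k)) (i k : ℕ) :
    piece v L i k * U i =
      if (L k).1 = i then (if (L k).2 then star (v k) else v k) else 0 := by
  by_cases hk : (L k).1 = i
  swap
  · simp [piece, hk]
  cases hb : (L k).2 <;> simp only [piece, hk, hb, if_true, Bool.false_eq_true, if_false]
  · have h1 := eq_mul_of_letter hv hk hb
    have hp := (isStarProjection_of_isometry (h.isometry k)).isIdempotentElem.eq
    have h2 : star (v k) = star (v k) * v k * star (U i) := by
      have := congrArg star h1
      simpa using this
    calc v k * star (v k) * U i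
        = v k * ((star (v k) * v k) * (star (U i) * U i)) := by
          conv_lhs => rw [h2]
          simp only [mul_assoc]
      _ = U i * (star (v k) * v k) * ((star (U i) * U i) * (star (v k) * v k)) := by
          rw [← h1, h.comm _ (h.star_mul_mem k) _ (hUA i)]
      _ = U i * ((star (v k) * v k) * (star (U i) * U i)) * (star (v k) * v k) := by
          simp only [mul_assoc]
      _ = U i * star (U i) * U i * ((star (v k) * v k) * (star (v k) * v k)) := by
          rw [h.comm _ (h.star_mul_mem k) _ (hUA i)]; simp only [mul_assoc]
      _ = v k := by rw [hUi, hp, ← h1]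
  · exact (star_eq_mul_of_letter hv hk hb).symm

theorem exists_isPartition_option {c : ℕ → H →L[ℂ] H} (hcA : ∀ k, c k ∈ A)
    (hc : ∀ k, IsStarProjection (c k)) (horth : ∀ k m, k ≠ m → c k * c m = 0) :
    ∃ f ∈ A, IsStarProjection f ∧ IsPartition (fun o : Option ℕ => o.elim f c) := by
  obtain ⟨f, hfA, hf, hcf, hfX⟩ := exists_kernel_projection A hcA
  have hstar : ∀ k, star (c k) = c k := fun k => (hc k).isSelfAdjoint.star_eq
  have hfc : ∀ k, f * c k = 0 := fun k => by
    have := congrArg star (hcf k)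
    rwa [star_mul, hstar, hf.isSelfAdjoint.star_eq, star_zero] at this
  refine ⟨f, hfA, hf, ⟨?_, ?_, fun X hX => ?_⟩⟩
  · rintro (_ | k)
    · simp [hf.isSelfAdjoint.star_eq, hf.isIdempotentElem.eq]
    · simp [hstar, (hc k).isIdempotentElem.eq]
  · rintro (_ | k) (_ | m) hkm
    · exact absurd rfl hkm
    · simpa [hstar] using hfc m
    · simpa [hf.isSelfAdjoint.star_eq] using hcf k
    · simpa [hstar] using horth k m fun hkm' => hkm (by rw [hkm'])
  · rw [← hfX X fun k => hX (some k)]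
    exact hX none

theorem IsPartition.commute {ι : Type*} {s : ι → H →L[ℂ] H} (hs : IsPartition s)
    {S X : H →L[ℂ] H} (h1 : ∀ i, S * s i = s i * S) (h2 : ∀ i, S * (s i * X) = s i * X * S) :
    S * X = X * S := by
  rw [← sub_eq_zero]
  refine hs.total _ fun i => ?_
  rw [mul_sub, ← mul_assoc, ← h1, mul_assoc, h2, mul_assoc, sub_self]

end Pieces

/-! ### Additivity of the trace over partitions -/

section Trace

variable {M : VonNeumannAlgebra H} {τ : (H →L[ℂ] H) →ₗ[ℂ] ℂ}

/-- The value of `τ` at `x* x`. -/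
noncomputable def mass (τ : (H →L[ℂ] H) →ₗ[ℂ] ℂ) (x : H →L[ℂ] H) : ENNReal :=
  ENNReal.ofReal (τ (star x * x)).re

theorem mass_star (hτ : IsFaithfulTracialState M τ) {x : H →L[ℂ] H} (hx : x ∈ M) :
    mass τ (star x) = mass τ x := by
  rw [mass, mass, star_star, hτ.tracial x hx _ (star_mem hx)]

theorem mass_zero : mass τ 0 = 0 := by simp [mass]

theorem cost_eq_tsum_mass (hτ : IsFaithfulTracialState M τ) {ι : Type*} {U : ι → H →L[ℂ] H}
    (hU : ∀ i, U i ∈ M) : cost τ U = ∑' i, mass τ (U i) := by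
  refine tsum_congr fun i => ?_
  rw [map_add, hτ.tracial _ (hU i) _ (star_mem (hU i)), mass]
  congr 1
  simp

/-- Finite sums of the right supports are projections converging strongly to `1`. Being
contractions, they allow dominated convergence in the vector series representing the normal
functional `τ`. -/
theorem hasSum_trace (hτ : IsFaithfulTracialState M τ) {ι : Type*} {s : ι → H →L[ℂ] H}
    (hs : IsPartition s) (hsM : ∀ i, s i ∈ M) {x : H →L[ℂ] H} (hx : x ∈ M) :
    HasSum (fun i => τ (star (s i * x) * (s i * x))) (τ (star x * x)) := by
  obtain ⟨ξ, η, hξ, hη, hτeq⟩ := hτ.normal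
  have hD : ∀ F : Finset ι, ∑ i ∈ F, τ (star (s i * x) * (s i * x)) =
      ∑' n, inner ℂ (η n) (star x ((∑ i ∈ F, star (s i) * s i) (x (ξ n)))) := by
    intro F
    rw [← map_sum, hτeq _ (sum_mem fun i _ => mul_mem (star_mem (mul_mem (hsM i) hx))
      (mul_mem (hsM i) hx))]
    refine tsum_congr fun n => ?_
    congr 1
    have : ∑ i ∈ F, star (s i * x) * (s i * x) = star x * (∑ i ∈ F, star (s i) * s i) * x := by
      rw [Finset.mul_sum, Finset.sum_mul]
      exact Finset.sum_congr rfl fun i _ => by simp only [star_mul, mul_assoc]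
    rw [this]
    rfl
  rw [HasSum, SummationFilter.unconditional_filter, hτeq _ (mul_mem (star_mem hx) hx)]
  simp_rw [hD]
  refine tendsto_tsum_of_dominated_convergence
    (bound := fun n => ‖star x‖ * ‖x‖ * (‖ξ n‖ ^ 2 + ‖η n‖ ^ 2)) ((hξ.add hη).mul_left _)
    (fun n => ?_) (Filter.Eventually.of_forall fun F n => ?_)
  · have h1 := hs.hasSum_one (x (ξ n))
    have h2 := (h1.mapL (star x)).mapL (innerSL ℂ (η n))
    rw [HasSum, SummationFilter.unconditional_filter] at h2
    refine h2.congr fun F => ?_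
    rw [← map_sum, ← map_sum, sum_apply]
    rfl
  · have hP := IsStarProjection.norm_le _ (hs.isStarProjection_sum F)
    have h1 : ‖star x ((∑ i ∈ F, star (s i) * s i) (x (ξ n)))‖ ≤ ‖star x‖ * (1 * (‖x‖ * ‖ξ n‖)) :=
      (star x).le_opNorm_of_le (ContinuousLinearMap.le_of_opNorm_le_of_le _ hP (x.le_opNorm _))
    refine (norm_inner_le_norm _ _).trans ((mul_le_mul_of_nonneg_left h1 (norm_nonneg _)).trans ?_)
    have h3 : ‖η n‖ * ‖ξ n‖ ≤ ‖ξ n‖ ^ 2 + ‖η n‖ ^ 2 := by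
      nlinarith [sq_nonneg (‖ξ n‖ - ‖η n‖), sq_nonneg ‖ξ n‖, sq_nonneg ‖η n‖]
    calc ‖η n‖ * (‖star x‖ * (1 * (‖x‖ * ‖ξ n‖))) = ‖star x‖ * ‖x‖ * (‖η n‖ * ‖ξ n‖) := by ring
      _ ≤ _ := mul_le_mul_of_nonneg_left h3 (by positivity)

theorem tsum_mass (hτ : IsFaithfulTracialState M τ) {ι : Type*} {s : ι → H →L[ℂ] H}
    (hs : IsPartition s) (hsM : ∀ i, s i ∈ M) {x : H →L[ℂ] H} (hx : x ∈ M) :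
    ∑' i, mass τ (s i * x) = mass τ x := by
  have h := (hasSum_trace hτ hs hsM hx).mapL Complex.reCLM
  have hnn : ∀ i, 0 ≤ (τ (star (s i * x) * (s i * x))).re := fun i =>
    (Complex.le_def.1 (hτ.nonneg _ (mul_mem (hsM i) hx))).1
  simp only [Complex.reCLM_apply] at h
  unfold mass
  rw [← ENNReal.ofReal_tsum_of_nonneg hnn h.summable, h.tsum_eq]

end Trace

theorem ennreal_tsum_option {ι : Type*} (f : Option ι → ENNReal) :
    ∑' o, f o = f none + ∑' i, f (some i) := by
  rw [← (Equiv.optionEquivSumPUnit.{0} ι).symm.tsum_eq,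
    Summable.tsum_sum ENNReal.summable ENNReal.summable, add_comm]
  simp

/-! ### Commutants of generating sets, in the whole algebra and in the corner -/

section Generators

variable {e : H →L[ℂ] H} {S S' : Set (H →L[ℂ] H)}

theorem mem_centralizer_generators {T : H →L[ℂ] H} :
    T ∈ Set.centralizer (S ∪ star '' S ∪ {e}) ↔
      (∀ x ∈ S, x * T = T * x) ∧ (∀ x ∈ S, star x * T = T * star x) ∧ e * T = T * e := by
  constructor
  · intro h
    exact ⟨fun x hx => h x (Or.inl (Or.inl hx)),
      fun x hx => h _ (Or.inl (Or.inr ⟨x, hx, rfl⟩)), h e (Or.inr rfl)⟩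
  · rintro ⟨h1, h2, h3⟩ x ((hx | ⟨y, hy, rfl⟩) | rfl)
    exacts [h1 x hx, h2 y hy, h3]

theorem vnGen_congr (h : ∀ T, T ∈ Set.centralizer (S ∪ star '' S ∪ {e}) ↔
    T ∈ Set.centralizer (S' ∪ star '' S' ∪ {e})) : vnGen e S = vnGen e S' := by
  rw [vnGen, vnGen, Set.ext h]

theorem commute_of_mem_vnGen {T x : H →L[ℂ] H} (hx : x ∈ vnGen e S)
    (hT : T ∈ Set.centralizer (S ∪ star '' S ∪ {e})) : T * x = x * T :=
  hx.1 T hT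

theorem mem_vnGen_one {x : H →L[ℂ] H}
    (hx : ∀ T ∈ Set.centralizer (S ∪ star '' S ∪ {1}), T * x = x * T) : x ∈ vnGen 1 S :=
  ⟨hx, by rw [one_mul, mul_one]⟩

end Generators

section Corner

variable {M A : VonNeumannAlgebra H} {E : (H →L[ℂ] H) →ₗ[ℂ] (H →L[ℂ] H)}
  {𝒢 : Set (H →L[ℂ] H)} {p : H →L[ℂ] H}

theorem corner_mul_eq (hp : IsStarProjection p) (x : H →L[ℂ] H) :
    p * (p * x * p) = p * x * p ∧ p * x * p * p = p * x * p ∧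
      star (p * x * p) = p * star x * p := by
  refine ⟨?_, ?_, ?_⟩
  · rw [← mul_assoc, ← mul_assoc, hp.isIdempotentElem.eq]
  · rw [mul_assoc, hp.isIdempotentElem.eq]
  · rw [star_mul, star_mul, hp.isSelfAdjoint.star_eq, mul_assoc]

theorem mem_corner_groupoid (h𝒢 : IsGroupoid M A E 𝒢) (hpA : p ∈ A) (hp : IsStarProjection p)
    {u : H →L[ℂ] H} (hu : u ∈ corner p 𝒢) : u ∈ 𝒢 ∧ p * u = u ∧ u * p = u := by
  obtain ⟨x, hx, rfl⟩ := hu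
  have hp𝒢 := h𝒢.proj_mem hpA hp
  exact ⟨h𝒢.mul_mem _ (h𝒢.mul_mem _ hp𝒢 _ hx) _ hp𝒢, (corner_mul_eq hp x).1,
    (corner_mul_eq hp x).2.1⟩

theorem mem_centralizer_corner (h𝒢 : IsGroupoid M A E 𝒢) (hpA : p ∈ A) (hp : IsStarProjection p)
    {T : H →L[ℂ] H} : T ∈ Set.centralizer (corner p 𝒢 ∪ star '' corner p 𝒢 ∪ {p}) ↔
      ∀ u ∈ 𝒢, T * (p * u * p) = p * u * p * T := by
  rw [mem_centralizer_generators]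
  constructor
  · rintro ⟨h1, -, -⟩ u hu
    exact (h1 _ ⟨u, hu, rfl⟩).symm
  · intro h
    refine ⟨?_, ?_, ?_⟩
    · rintro _ ⟨u, hu, rfl⟩
      exact (h u hu).symm
    · rintro _ ⟨u, hu, rfl⟩
      change star (p * u * p) * T = T * star (p * u * p)
      rw [(corner_mul_eq hp u).2.2]
      exact (h _ (h𝒢.star_mem u hu)).symm
    · have := h p (h𝒢.proj_mem hpA hp)
      rw [hp.isIdempotentElem.eq, hp.isIdempotentElem.eq] at this
      exact this.symm

theorem mem_centralizer_corner_union (hp : IsStarProjection p) {ι : Type*} {V : ι → H →L[ℂ] H}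
    {T : H →L[ℂ] H} :
    T ∈ Set.centralizer ((corner p (A : Set (H →L[ℂ] H)) ∪ Set.range V) ∪
      star '' (corner p (A : Set (H →L[ℂ] H)) ∪ Set.range V) ∪ {p}) ↔
      (∀ a ∈ A, T * (p * a * p) = p * a * p * T) ∧ (∀ i, T * V i = V i * T) ∧
        ∀ i, T * star (V i) = star (V i) * T := by
  rw [mem_centralizer_generators]
  constructor
  · rintro ⟨h1, h2, -⟩
    exact ⟨fun a ha => (h1 _ (Or.inl ⟨a, ha, rfl⟩)).symm,
      fun i => (h1 _ (Or.inr ⟨i, rfl⟩)).symm, fun i => (h2 _ (Or.inr ⟨i, rfl⟩)).symm⟩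
  · rintro ⟨h1, h2, h3⟩
    refine ⟨?_, ?_, ?_⟩
    · rintro _ (⟨a, ha, rfl⟩ | ⟨i, rfl⟩)
      exacts [(h1 a ha).symm, (h2 i).symm]
    · rintro _ (⟨a, ha, rfl⟩ | ⟨i, rfl⟩)
      · change star (p * a * p) * T = T * star (p * a * p)
        rw [(corner_mul_eq hp a).2.2]
        exact (h1 _ (star_mem ha)).symm
      · exact (h3 i).symm
    · have := h1 1 (one_mem A)
      rw [mul_one, hp.isIdempotentElem.eq] at this
      exact this.symm

theorem mem_centralizer_union {ι : Type*} {V : ι → H →L[ℂ] H} {T : H →L[ℂ] H} :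
    T ∈ Set.centralizer (((A : Set (H →L[ℂ] H)) ∪ Set.range V) ∪
      star '' ((A : Set (H →L[ℂ] H)) ∪ Set.range V) ∪ {1}) ↔
      (∀ a ∈ A, T * a = a * T) ∧ (∀ i, T * V i = V i * T) ∧
        ∀ i, T * star (V i) = star (V i) * T := by
  rw [mem_centralizer_generators]
  constructor
  · rintro ⟨h1, h2, -⟩
    exact ⟨fun a ha => (h1 _ (Or.inl ha)).symm,
      fun i => (h1 _ (Or.inr ⟨i, rfl⟩)).symm, fun i => (h2 _ (Or.inr ⟨i, rfl⟩)).symm⟩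
  · rintro ⟨h1, h2, h3⟩
    refine ⟨?_, ?_, by rw [one_mul, mul_one]⟩
    · rintro _ (ha | ⟨i, rfl⟩)
      exacts [(h1 _ ha).symm, (h2 i).symm]
    · rintro _ (ha | ⟨i, rfl⟩)
      exacts [(h1 _ (star_mem ha)).symm, (h3 i).symm]

theorem mem_centralizer_groupoid (h𝒢 : IsGroupoid M A E 𝒢) {T : H →L[ℂ] H} :
    T ∈ Set.centralizer (𝒢 ∪ star '' 𝒢 ∪ {1}) ↔ ∀ u ∈ 𝒢, T * u = u * T := by
  rw [mem_centralizer_generators]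
  constructor
  · rintro ⟨h1, -, -⟩ u hu
    exact (h1 u hu).symm
  · intro h
    exact ⟨fun u hu => (h u hu).symm, fun u hu => (h _ (h𝒢.star_mem u hu)).symm,
      by rw [one_mul, mul_one]⟩

end Corner

/-! ### The tower as treeing: abelian base, graphings, treeings, cost -/

namespace IsTower

variable {M A : VonNeumannAlgebra H} {E : (H →L[ℂ] H) →ₗ[ℂ] (H →L[ℂ] H)}
  {𝒢 : Set (H →L[ℂ] H)} {p : H →L[ℂ] H} {v F : ℕ → H →L[ℂ] H}

theorem mem_vnGen (h : IsTower A p v F) : p ∈ vnGen 1 ((A : Set (H →L[ℂ] H)) ∪ Set.range v) :=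
  mem_vnGen_one fun _ hT => (mem_centralizer_union.1 hT).1 p h.base_mem

/-- If `T` commutes with `A`, its amplification commutes with `A` and `v`, hence with `x` in the
generated algebra. Compressing by `p` shows that `T` commutes with `p * x * p`, so this element lies
in `A`. -/
theorem isAbelianProj (h : IsTower A p v F) :
    IsAbelianProj (vnGen 1 ((A : Set (H →L[ℂ] H)) ∪ Set.range v)) p := by
  have key : ∀ x ∈ vnGen 1 ((A : Set (H →L[ℂ] H)) ∪ Set.range v), p * x * p ∈ A := by
    intro x hx
    refine mem_of_commutant A fun T hT _ => ?_
    have hTA : ∀ a ∈ A, T * (p * a * p) = p * a * p * T := fun a ha =>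
      (hT _ (mul_mem (mul_mem h.base_mem ha) h.base_mem)).symm
    obtain ⟨S, h1, h2, h3⟩ := h.exists_amplification hTA
    have hSx : S * x = x * S := commute_of_mem_vnGen hx (mem_centralizer_union.2
      ⟨fun a ha => h3 a fun m n => h.commute_descent hTA m n ha,
        fun k => h3 _ fun m n => h.commute_descent_apply hTA k m n,
        fun k => h3 _ fun m n => h.commute_descent_star hTA k m n⟩)
    calc T * (p * x * p) = (T * p) * x * p := by simp only [mul_assoc]
      _ = p * (S * x) * p := by rw [← h2]; simp only [mul_assoc]
      _ = p * x * (S * p) := by rw [hSx]; simp only [mul_assoc]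
      _ = p * x * p * T := by rw [h1]; simp only [mul_assoc]
  exact ⟨h.mem_vnGen, h.base_proj, fun x hx y hy => h.comm _ (key x hx) _ (key y hy)⟩

/-- A central projection dominating `p` commutes with each `v k`, so it inherits every increment
from the projection `F k` into which `v k` maps it. -/
theorem isCentralSupport (h : IsTower A p v F) :
    IsCentralSupport (vnGen 1 ((A : Set (H →L[ℂ] H)) ∪ Set.range v)) p 1 := by
  refine ⟨⟨mem_vnGen_one fun T _ => by rw [one_mul, mul_one], fun x _ => by rw [one_mul, mul_one],
    IsStarProjection.one _⟩, one_mul p, fun z hz hzp => ?_⟩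
  have hA : ∀ a ∈ A, a * z = z * a := fun a ha =>
    hz.2.1 a (mem_vnGen_one fun _ hT => (mem_centralizer_union.1 hT).1 a ha)
  have hv : ∀ k, v k * z = z * v k := fun k =>
    hz.2.1 _ (mem_vnGen_one fun _ hT => (mem_centralizer_union.1 hT).2.1 k)
  have : 1 - z = 0 := by
    refine h.total _ fun k => ?_
    induction k with
    | zero => rw [h.base, mul_sub, hA p h.base_mem, hzp, mul_one, sub_self]
    | succ k ih =>
      have h1 : v k * (1 - z) = 0 := by
        calc v k * (1 - z) = (1 - z) * (F k * v k) := by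
              rw [h.range, mul_sub, sub_mul, hv, mul_one, one_mul]
          _ = F k * (1 - z) * v k := by
              rw [← mul_assoc, mul_sub, sub_mul, hA _ (h.mem k), mul_one, one_mul]
          _ = 0 := by rw [ih, zero_mul]
      rw [h.succ, add_mul, ih, mul_assoc, h1, mul_zero, add_zero]
  rw [mul_one]
  exact (sub_eq_zero.1 this).symm

theorem descent_mem_groupoid (h : IsTower A p v F) (h𝒢 : IsGroupoid M A E 𝒢)
    (hv : ∀ k, v k ∈ 𝒢) (l : List ℕ) : descent p v l ∈ 𝒢 := by
  induction l with
  | nil => exact h𝒢.proj_mem h.base_mem h.base_proj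
  | cons k l ih => exact h𝒢.mul_mem _ ih _ (hv k)

/-- The blocks of `u` along descents are groupoid elements in the corner, hence generated by `A p`
and `V`. An operator commuting with these blocks and with the descents commutes with `u`. -/
theorem isGraphing_elim (h : IsTower A p v F) (h𝒢 : IsGroupoid M A E 𝒢) (hAM : ∀ x ∈ A, x ∈ M)
    (h𝒢M : vnGen 1 𝒢 = (M : Set (H →L[ℂ] H))) (hv : ∀ k, v k ∈ 𝒢) {κ : Type*}
    {V : κ → H →L[ℂ] H}
    (hV : IsGraphing p (corner p (A : Set (H →L[ℂ] H))) (corner p 𝒢) V) :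
    IsGraphing 1 (A : Set (H →L[ℂ] H)) 𝒢 (Sum.elim v V) := by
  obtain ⟨hκ, hV𝒢, hVgen⟩ := hV
  have hp := h.base_proj
  have hW : ∀ i, Sum.elim v V i ∈ 𝒢 := by
    rintro (k | i)
    exacts [hv k, (mem_corner_groupoid h𝒢 h.base_mem hp (hV𝒢 i)).1]
  refine ⟨inferInstance, hW, vnGen_congr fun T => ?_⟩
  rw [mem_centralizer_union, mem_centralizer_groupoid h𝒢]
  constructor
  · intro hT
    refine ⟨fun a ha => ?_, fun i => hT _ (hW i), fun i => hT _ (h𝒢.star_mem _ (hW i))⟩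
    have : a ∈ vnGen 1 𝒢 := by rw [h𝒢M]; exact hAM a ha
    exact commute_of_mem_vnGen this ((mem_centralizer_groupoid h𝒢).2 hT)
  · rintro ⟨h1, h2, h3⟩ u hu
    have hTp : T ∈ Set.centralizer ((corner p (A : Set (H →L[ℂ] H)) ∪ Set.range V) ∪
        star '' (corner p (A : Set (H →L[ℂ] H)) ∪ Set.range V) ∪ {p}) :=
      (mem_centralizer_corner_union hp).2
        ⟨fun a ha => h1 _ (mul_mem (mul_mem h.base_mem ha) h.base_mem),
          fun i => h2 (Sum.inr i), fun i => h3 (Sum.inr i)⟩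
    have hTc : ∀ u ∈ 𝒢, T * (p * u * p) = p * u * p * T := by
      intro u hu
      refine commute_of_mem_vnGen (e := p) ?_ hTp
      rw [← hVgen]
      refine ⟨fun S hS => (mem_centralizer_corner h𝒢 h.base_mem hp).1 hS u hu, ?_⟩
      rw [(corner_mul_eq hp u).1, (corner_mul_eq hp u).2.1]
    have hs := h.descent_mem_groupoid h𝒢 hv
    have hTs : ∀ l, T * descent p v l = descent p v l * T := by
      intro l
      induction l with
      | nil => exact h1 p h.base_mem
      | cons k l ih =>
        rw [descent, ← mul_assoc, ih, mul_assoc, mul_assoc, show T * v k = v k * T from h2 (Sum.inl k)]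
    have hTs' : ∀ l, T * star (descent p v l) = star (descent p v l) * T := by
      intro l
      induction l with
      | nil => rw [descent, hp.isSelfAdjoint.star_eq]; exact h1 p h.base_mem
      | cons k l ih =>
        rw [descent, star_mul, ← mul_assoc, mul_assoc (star (v k)), ← ih, ← mul_assoc,
          show T * star (v k) = star (v k) * T from h3 (Sum.inl k)]
    rw [← sub_eq_zero]
    refine h.isPartition_descent.total _ fun m =>
      h.isPartition_descent.eq_zero_of_mul_star fun n => ?_
    have hc := hTc _ (h𝒢.mul_mem _ (h𝒢.mul_mem _ (hs m) _ hu) _ (h𝒢.star_mem _ (hs n)))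
    rw [h.corner_descent] at hc
    calc descent p v m * (T * u - u * T) * star (descent p v n)
        = (descent p v m * T) * u * star (descent p v n) -
            descent p v m * u * (T * star (descent p v n)) := by
          simp only [mul_sub, sub_mul, mul_assoc]
      _ = 0 := by
          rw [← hTs, hTs', sub_eq_zero, ← mul_assoc _ _ T, ← hc]
          simp only [mul_assoc]

theorem isTreeing_elim_iff (h : IsTower A p v F) (hE : IsCondExp M A E)
    (h𝒢 : IsGroupoid M A E 𝒢) (hv : ∀ k, v k ∈ 𝒢) {κ : Type*} [Countable κ]
    {V : κ → H →L[ℂ] H} (hV : ∀ i, V i ∈ corner p 𝒢) :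
    IsTreeing (M : Set (H →L[ℂ] H)) A E (Sum.elim v V) ↔
      IsTreeing (corner p (M : Set (H →L[ℂ] H))) (corner p A) E V := by
  have hV' := fun i => mem_corner_groupoid h𝒢 h.base_mem h.base_proj (hV i)
  constructor
  · intro ht
    exact ⟨inferInstance, fun i => h𝒢.mem_fullGroupoid_corner h.comm h.base_mem h.base_proj
      (hV' i).1 (hV' i).2.1 (hV' i).2.2, (ht.comp_injective Sum.inr_injective).2.2⟩
  · rintro ⟨-, -, hw⟩
    refine ⟨inferInstance, ?_, h.condExp_reduced_word_eq_zero hE (fun k => h𝒢.mem_alg (hv k))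
      (fun i => h𝒢.mem_alg (hV' i).1) (fun k x hx => ?_) (fun i => (hV' i).2.1)
      (fun i => (hV' i).2.2) hw⟩
    · rintro (k | i)
      exacts [h𝒢.subset_full (hv k), h𝒢.subset_full (hV' i).1]
    · have := h𝒢.equivariant _ (h𝒢.star_mem _ (hv k)) x hx
      rwa [star_star] at this

theorem isTreeing (h : IsTower A p v F) (hE : IsCondExp M A E)
    (h𝒢 : IsGroupoid M A E 𝒢) (hv : ∀ k, v k ∈ 𝒢) :
    IsTreeing (M : Set (H →L[ℂ] H)) A E v := by
  -- The empty family is a treeing of the corner.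
  have h1 := (h.isTreeing_elim_iff hE h𝒢 hv (κ := Empty) (V := Empty.elim) (fun i => i.elim)).2
    ⟨inferInstance, fun i => i.elim, fun w hw _ => by
      cases w with
      | nil => exact absurd rfl hw
      | cons l _ => exact l.1.elim⟩
  exact h1.comp_injective Sum.inl_injective

theorem cost_eq (h : IsTower A p v F) {τ : (H →L[ℂ] H) →ₗ[ℂ] ℂ}
    (hτ : IsFaithfulTracialState M τ) (hpM : p ∈ M) (hv : ∀ k, v k ∈ M) :
    cost τ v = ENNReal.ofReal (1 - (τ p).re) := by
  have h1 := tsum_mass hτ h.isPartition_option (by rintro (_ | k); exacts [hpM, hv k]) (one_mem M)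
  have hp := h.base_proj
  have hmp : mass τ p = ENNReal.ofReal (τ p).re := by
    rw [mass, hp.isSelfAdjoint.star_eq, hp.isIdempotentElem.eq]
  have hp0 : 0 ≤ (τ p).re := by
    have := (Complex.le_def.1 (hτ.nonneg p hpM)).1
    rwa [hp.isSelfAdjoint.star_eq, hp.isIdempotentElem.eq] at this
  have hm1 : mass τ (1 : H →L[ℂ] H) = 1 := by simp [mass, hτ.map_one]
  rw [ennreal_tsum_option, hm1] at h1
  simp only [Option.elim, mul_one] at h1
  rw [cost_eq_tsum_mass hτ hv, ENNReal.ofReal_sub _ hp0, ENNReal.ofReal_one, ← h1, hmp,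
    ENNReal.add_sub_cancel_left ENNReal.ofReal_ne_top]

end IsTower

/-! ### The remainders as a graphing of the corner -/

theorem exists_letter_sequence :
    ∃ L : ℕ → ℕ × Bool, ∀ x N, ∃ m, N ≤ m ∧ L m = x := by
  obtain ⟨e, he⟩ := exists_surjective_nat (ℕ × Bool)
  refine ⟨fun k => e (Nat.unpair k).1, fun x N => ?_⟩
  obtain ⟨m, rfl⟩ := he x
  -- The first coordinate of the pairing selects the letter; the second is free and makes it recur
  -- beyond every bound.
  exact ⟨Nat.pair m N, Nat.right_le_pair m N, by simp⟩

/-- The remainders `f i * U i` of the elements of a graphing, cut along the tower and transported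
to the corner of `p`. -/
noncomputable def transport (p : H →L[ℂ] H) (v f U : ℕ → H →L[ℂ] H) (x : ℕ × List ℕ × List ℕ) :
    H →L[ℂ] H :=
  descent p v x.2.1 * (f x.1 * U x.1) * star (descent p v x.2.2)

section Transport

variable {M A : VonNeumannAlgebra H} {E : (H →L[ℂ] H) →ₗ[ℂ] (H →L[ℂ] H)}
  {𝒢 : Set (H →L[ℂ] H)} {p : H →L[ℂ] H} {v F f U : ℕ → H →L[ℂ] H} {L : ℕ → ℕ × Bool}

/-- Summing the masses of `s_m x s_n*` over `m` gives that of `x s_n*`, which by traciality is that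
of `s_n x*`; summing over `n` then gives the mass of `x`. -/
theorem cost_transport (h : IsTower A p v F) {τ : (H →L[ℂ] H) →ₗ[ℂ] ℂ}
    (hτ : IsFaithfulTracialState M τ) (hs : ∀ l, descent p v l ∈ M) (hf : ∀ i, f i ∈ M)
    (hU : ∀ i, U i ∈ M) : cost τ (transport p v f U) = ∑' i, mass τ (f i * U i) := by
  have hP := h.isPartition_descent
  have hx : ∀ i, f i * U i ∈ M := fun i => mul_mem (hf i) (hU i)
  rw [cost_eq_tsum_mass (U := transport p v f U) hτ fun x => mul_mem (mul_mem (hs _) (hx _)) (star_mem (hs _)),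
    ENNReal.tsum_prod (f := fun i y => mass τ (transport p v f U (i, y)))]
  refine tsum_congr fun i => ?_
  rw [ENNReal.tsum_prod (f := fun m n => mass τ (transport p v f U (i, m, n))), ENNReal.tsum_comm]
  have h1 : ∀ n, ∑' m, mass τ (transport p v f U (i, m, n)) =
      mass τ (descent p v n * star (f i * U i)) := by
    intro n
    rw [← mass_star hτ (mul_mem (hs n) (star_mem (hx i))), star_mul, star_star,
      ← tsum_mass hτ hP hs (mul_mem (hx i) (star_mem (hs n)))]
    exact tsum_congr fun m => by rw [transport, mul_assoc]
  simp_rw [h1]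
  rw [tsum_mass hτ hP hs (star_mem (hx i)), mass_star hτ (hx i)]

/-- Each `v k` is a piece of exactly one `U i`, so interchanging the sums counts its mass once. All
terms are in `[0, ∞]`, so no finiteness is needed. -/
theorem cost_eq_add (h : IsTower A p v F) {τ : (H →L[ℂ] H) →ₗ[ℂ] ℂ}
    (hτ : IsFaithfulTracialState M τ) (hAM : ∀ x ∈ A, x ∈ M) (hvM : ∀ k, v k ∈ M)
    (hfA : ∀ i, f i ∈ A) (hUM : ∀ i, U i ∈ M)
    (hf : ∀ i, IsPartition fun o : Option ℕ => o.elim (f i) (piece v L i))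
    (hpiece : ∀ i k, piece v L i k * U i =
      if (L k).1 = i then (if (L k).2 then star (v k) else v k) else 0) :
    cost τ U = cost τ v + ∑' i, mass τ (f i * U i) := by
  rw [cost_eq_tsum_mass hτ hUM, cost_eq_tsum_mass hτ hvM]
  have h1 : ∀ i, mass τ (U i) =
      mass τ (f i * U i) + ∑' k, if (L k).1 = i then mass τ (v k) else 0 := by
    intro i
    rw [← tsum_mass hτ (hf i) (by
      rintro (_ | k)
      exacts [hAM _ (hfA i), hAM _ (piece_mem h i k)]) (hUM i), ennreal_tsum_option]
    congr 1
    refine tsum_congr fun k => ?_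
    simp only [Option.elim, hpiece]
    split_ifs
    · exact mass_star hτ (hvM k)
    · rfl
    · exact mass_zero
  simp_rw [h1]
  rw [ENNReal.tsum_add, add_comm, ENNReal.tsum_comm]
  congr 1
  refine tsum_congr fun k => ?_
  rw [tsum_eq_single (L k).1 fun i hi => if_neg hi.symm, if_pos rfl]

/-- The amplification of an operator commuting with `A p` and the transported blocks commutes with
the `v k` and with the remainders. It therefore commutes with every `U i`, reassembled from its
pieces, and so with `M`. Compression by `p` returns to the corner. -/
theorem isGraphing_transport (h : IsTower A p v F) (h𝒢 : IsGroupoid M A E 𝒢)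
    (hv : ∀ k, v k ∈ 𝒢) (hfA : ∀ i, f i ∈ A) (hfp : ∀ i, IsStarProjection (f i))
    (hU : ∀ i, U i ∈ 𝒢)
    (hf : ∀ i, IsPartition fun o : Option ℕ => o.elim (f i) (piece v L i))
    (hpiece : ∀ i k, piece v L i k * U i =
      if (L k).1 = i then (if (L k).2 then star (v k) else v k) else 0)
    (hgen : ∀ T : H →L[ℂ] H, (∀ a ∈ A, T * a = a * T) → (∀ i, T * U i = U i * T) →
      (∀ i, T * star (U i) = star (U i) * T) → ∀ x ∈ M, T * x = x * T) :
    IsGraphing p (corner p (A : Set (H →L[ℂ] H))) (corner p 𝒢) (transport p v f U) := by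
  have hp := h.base_proj
  have hs := h.descent_mem_groupoid h𝒢 hv
  have hfix : ∀ x, p * transport p v f U x * p = transport p v f U x := fun x =>
    h.corner_descent _ _ _
  have hmem : ∀ x, transport p v f U x ∈ 𝒢 := fun x =>
    h𝒢.mul_mem _ (h𝒢.mul_mem _ (hs _) _ (h𝒢.mul_mem _ (h𝒢.proj_mem (hfA _) (hfp _)) _ (hU _))) _
      (h𝒢.star_mem _ (hs _))
  refine ⟨inferInstance, fun x => ⟨_, hmem x, hfix x⟩, vnGen_congr fun T => ?_⟩
  rw [mem_centralizer_corner h𝒢 h.base_mem hp, mem_centralizer_corner_union hp]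
  constructor
  · intro hT
    refine ⟨fun a ha => commute_of_commute_unitary A
      (fun u hu hu' => hT u (h𝒢.partialIsometry_mem u hu hu')) ha, fun x => ?_, fun x => ?_⟩
    · have := hT _ (hmem x)
      rwa [hfix] at this
    · have := hT _ (h𝒢.star_mem _ (hmem x))
      rwa [← (corner_mul_eq hp _).2.2, hfix] at this
  · rintro ⟨hT, hTU, hTU'⟩ u hu
    obtain ⟨S, h1, h2, h3⟩ := h.exists_amplification hT
    have hSA : ∀ a ∈ A, S * a = a * S := fun a ha => h3 a fun m n => h.commute_descent hT m n ha
    have hSv : ∀ k, S * v k = v k * S := fun k =>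
      h3 _ fun m n => h.commute_descent_apply hT k m n
    have hSv' : ∀ k, S * star (v k) = star (v k) * S := fun k =>
      h3 _ fun m n => h.commute_descent_star hT k m n
    have hSf : ∀ i, S * (f i * U i) = f i * U i * S := fun i =>
      h3 _ fun m n => hTU (i, m, n)
    have hSf' : ∀ i, S * star (f i * U i) = star (f i * U i) * S := fun i => by
      refine h3 _ fun m n => ?_
      have := hTU' (i, n, m)
      simpa only [transport, star_mul, star_star, mul_assoc] using this
    have hSU : ∀ i, S * U i = U i * S := fun i => by
      refine (hf i).commute ?_ ?_
      · rintro (_ | k)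
        exacts [hSA _ (hfA i), hSA _ (piece_mem h i k)]
      · rintro (_ | k)
        · exact hSf i
        · simp only [Option.elim, hpiece]
          split_ifs
          exacts [hSv' k, hSv k, by rw [mul_zero, zero_mul]]
    have hstar : ∀ x, S * star x = star x * S → star S * x = x * star S := fun x hx => by
      have := congrArg star hx
      simpa using this.symm
    have hSU' : ∀ i, S * star (U i) = star (U i) * S := fun i => by
      -- The pieces cut `U i` from the left only; commutation with `star (U i)` is obtained by
      -- applying the same argument to `star S`.
      have : star S * U i = U i * star S := by
        refine (hf i).commute ?_ ?_
        · rintro (_ | k)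
          exacts [hstar _ (hSA _ (star_mem (hfA i))), hstar _ (hSA _ (star_mem (piece_mem h i k)))]
        · rintro (_ | k)
          · exact hstar _ (hSf' i)
          · simp only [Option.elim, hpiece]
            split_ifs
            · exact hstar _ (by rw [star_star]; exact hSv k)
            · exact hstar _ (hSv' k)
            · rw [mul_zero, zero_mul]
      have := congrArg star this
      simpa using this.symm
    have hSu := hgen S hSA hSU hSU' u (h𝒢.mem_alg hu)
    calc T * (p * u * p) = (T * p) * u * p := by simp only [mul_assoc]
      _ = p * (S * u) * p := by rw [← h2]; simp only [mul_assoc]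
      _ = p * u * (S * p) := by rw [hSu]; simp only [mul_assoc]
      _ = p * u * p * T := by rw [h1]; simp only [mul_assoc]

end Transport

/-- The tower of a graphing, together with the remainders of the elements of the graphing. -/
theorem exists_tower {M A : VonNeumannAlgebra H} {E : (H →L[ℂ] H) →ₗ[ℂ] (H →L[ℂ] H)}
    {𝒢 : Set (H →L[ℂ] H)} {p : H →L[ℂ] H} {U : ℕ → H →L[ℂ] H}
    (h𝒢 : IsGroupoid M A E 𝒢) (hAM : ∀ x ∈ A, x ∈ M)
    (hA : ∀ a ∈ A, ∀ b ∈ A, a * b = b * a) (hpA : p ∈ A) (hp : IsStarProjection p)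
    (hpM : IsCentralSupport (M : Set (H →L[ℂ] H)) p 1) (hU : ∀ i, U i ∈ 𝒢)
    (hgen : ∀ T : H →L[ℂ] H, (∀ a ∈ A, T * a = a * T) → (∀ i, T * U i = U i * T) →
      (∀ i, T * star (U i) = star (U i) * T) → ∀ x ∈ M, T * x = x * T) :
    ∃ (v F f : ℕ → H →L[ℂ] H) (L : ℕ → ℕ × Bool), IsTower A p v F ∧ (∀ k, v k ∈ 𝒢) ∧
      (∀ i, f i ∈ A) ∧ (∀ i, IsStarProjection (f i)) ∧
      (∀ i, IsPartition fun o : Option ℕ => o.elim (f i) (piece v L i)) ∧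
      ∀ i k, piece v L i k * U i =
        if (L k).1 = i then (if (L k).2 then star (v k) else v k) else 0 := by
  obtain ⟨L, hL⟩ := exists_letter_sequence
  have hg : ∀ k, letter U (L k) ∈ 𝒢 := fun k => h𝒢.letter_mem hU (L k)
  have htower : IsTower A p (stepDown p fun k => letter U (L k))
      (climb p fun k => letter U (L k)) := by
    refine isTower_climb h𝒢 hAM hA hpA hp hg hpM (fun k N => ?_) (fun k => ?_)
      fun T hT hTg x hx => ?_
    · obtain ⟨m, hm, hm'⟩ := hL (L k) N
      exact ⟨m, hm, by rw [hm']⟩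
    · obtain ⟨m, -, hm⟩ := hL ((L k).1, !(L k).2) 0
      refine ⟨m, ?_⟩
      rw [hm]
      cases hb : (L k).2 <;> simp [letter, hb]
    · have hTl : ∀ l, letter U l * T = T * letter U l := fun l => by
        obtain ⟨m, -, rfl⟩ := hL l 0
        exact hTg m
      exact (hgen T (fun a ha => (hT a ha).symm) (fun i => (hTl (i, true)).symm)
        (fun i => (hTl (i, false)).symm) x hx).symm
  have hv := stepDown_mem h𝒢 hA hpA hp hg
  have hrel : ∀ k, stepDown p (fun k => letter U (L k)) k = star (letter U (L k)) *
      (star (stepDown p (fun k => letter U (L k)) k) *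
        stepDown p (fun k => letter U (L k)) k) := fun k => by
    rw [star_stepDown_mul h𝒢 hA hpA hp hg]
    rfl
  have hUA := fun i => h𝒢.star_mul_mem (hU i)
  choose f hfA hfp hf using fun i =>
    exists_isPartition_option (A := A) (fun k => piece_mem (L := L) htower i k)
      (fun k => isStarProjection_piece htower i k)
      fun k m hkm => piece_mul_piece htower hUA hrel i hkm
  exact ⟨_, _, f, L, htower, hv, hfA, hfp, hf,
    piece_mul htower hUA (fun i => h𝒢.isometry (hU i)) hrel⟩

theorem cost_extend {ι : Type*} {e : ι → ℕ} (he : Function.Injective e)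
    (τ : (H →L[ℂ] H) →ₗ[ℂ] ℂ) (U : ι → H →L[ℂ] H) :
    cost τ (Function.extend e U 0) = cost τ U := by
  unfold cost
  rw [← tsum_extend_zero he]
  refine tsum_congr fun n => ?_
  by_cases hn : ∃ i, e i = n
  · obtain ⟨i, rfl⟩ := hn
    simp only [he.extend_apply]
  · simp [Function.extend_apply' _ _ _ hn]

end NormalizingGroupoid

/-! ### The main theorem -/

theorem mainTheorem7 {H : Type*} [NormedAddCommGroup H] [InnerProductSpace ℂ H] [CompleteSpace H]
    (M A : VonNeumannAlgebra H) (hAM : ∀ x ∈ A, x ∈ M)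
    (hA : ∀ a ∈ A, ∀ b ∈ A, a * b = b * a)
    (E : (H →L[ℂ] H) →ₗ[ℂ] (H →L[ℂ] H)) (hE : NormalizingGroupoid.IsCondExp M A E)
    (τ : (H →L[ℂ] H) →ₗ[ℂ] ℂ) (hτ : NormalizingGroupoid.IsFaithfulTracialState M τ)
    (hτE : ∀ x ∈ M, τ (E x) = τ x)
    (𝒢 : Set (H →L[ℂ] H)) (h𝒢 : NormalizingGroupoid.IsGroupoid M A E 𝒢)
    (h𝒢M : NormalizingGroupoid.vnGen 1 𝒢 = (M : Set (H →L[ℂ] H)))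
    (p : H →L[ℂ] H) (hpA : p ∈ A) (hp : IsStarProjection p)
    (hpM : NormalizingGroupoid.IsCentralSupport (M : Set (H →L[ℂ] H)) p 1)
    {ι : Type*} (U : ι → H →L[ℂ] H)
    (hU : NormalizingGroupoid.IsGraphing 1 (A : Set (H →L[ℂ] H)) 𝒢 U) :
    ∃ (ιv ιh : Type) (Uv : ιv → H →L[ℂ] H) (Uh : ιh → H →L[ℂ] H),
      NormalizingGroupoid.IsTreeing (M : Set (H →L[ℂ] H)) A E Uv ∧
      NormalizingGroupoid.IsGraphing p (NormalizingGroupoid.corner p A)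
        (NormalizingGroupoid.corner p 𝒢) Uh ∧
      -- (a)
      NormalizingGroupoid.IsAbelianProj
        (NormalizingGroupoid.vnGen 1 ((A : Set (H →L[ℂ] H)) ∪ Set.range Uv)) p ∧
      NormalizingGroupoid.IsCentralSupport
        (NormalizingGroupoid.vnGen 1 ((A : Set (H →L[ℂ] H)) ∪ Set.range Uv)) p 1 ∧
      -- (b)
      (∀ (κ : Type) (V : κ → H →L[ℂ] H),
        NormalizingGroupoid.IsGraphing p (NormalizingGroupoid.corner p A)
          (NormalizingGroupoid.corner p 𝒢) V →
        NormalizingGroupoid.IsGraphing 1 (A : Set (H →L[ℂ] H)) 𝒢 (Sum.elim Uv V)) ∧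
      -- (c)
      (∀ (κ : Type) (V : κ → H →L[ℂ] H),
        NormalizingGroupoid.IsGraphing p (NormalizingGroupoid.corner p A)
          (NormalizingGroupoid.corner p 𝒢) V →
        (NormalizingGroupoid.IsTreeing (M : Set (H →L[ℂ] H)) A E (Sum.elim Uv V) ↔
          NormalizingGroupoid.IsTreeing (NormalizingGroupoid.corner p M)
            (NormalizingGroupoid.corner p A) E V)) ∧
      -- (d)
      NormalizingGroupoid.cost τ U =
        NormalizingGroupoid.cost τ Uv + NormalizingGroupoid.cost τ Uh ∧
      NormalizingGroupoid.cost τ Uv = ENNReal.ofReal (1 - (τ p).re) := by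
  obtain ⟨hι, hU𝒢, hUgen⟩ := hU
  -- The graphing is padded with zeros to be indexed by `ℕ`; zeros belong to the groupoid, generate
  -- nothing and cost nothing.
  obtain ⟨e, he⟩ := exists_injective_nat ι
  have hU' : ∀ n, Function.extend e U 0 n ∈ 𝒢 := fun n => by
    by_cases hn : ∃ i, e i = n
    · obtain ⟨i, rfl⟩ := hn
      rw [he.extend_apply]
      exact hU𝒢 i
    · rw [Function.extend_apply' _ _ _ hn]
      exact h𝒢.partialIsometry_mem 0 (zero_mem A) (by simp)
  have hgen : ∀ T : H →L[ℂ] H, (∀ a ∈ A, T * a = a * T) →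
      (∀ n, T * Function.extend e U 0 n = Function.extend e U 0 n * T) →
      (∀ n, T * star (Function.extend e U 0 n) = star (Function.extend e U 0 n) * T) →
      ∀ x ∈ M, T * x = x * T := by
    intro T h1 h2 h3 x hx
    have hx' : x ∈ NormalizingGroupoid.vnGen 1 ((A : Set (H →L[ℂ] H)) ∪ Set.range U) := by
      rw [← hUgen, h𝒢M]
      exact hx
    refine NormalizingGroupoid.commute_of_mem_vnGen hx'
      (NormalizingGroupoid.mem_centralizer_union.2 ⟨h1, fun i => ?_, fun i => ?_⟩)
    · simpa only [he.extend_apply] using h2 (e i)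
    · simpa only [he.extend_apply] using h3 (e i)
  obtain ⟨v, F, f, L, htower, hv, hfA, hfp, hf, hpiece⟩ :=
    NormalizingGroupoid.exists_tower h𝒢 hAM hA hpA hp hpM hU' hgen
  have hvM := fun k => h𝒢.mem_alg (hv k)
  have hUM := fun n => h𝒢.mem_alg (hU' n)
  refine ⟨ℕ, ℕ × List ℕ × List ℕ, v,
    NormalizingGroupoid.transport p v f (Function.extend e U 0), htower.isTreeing hE h𝒢 hv,
    NormalizingGroupoid.isGraphing_transport htower h𝒢 hv hfA hfp hU' hf hpiece hgen,
    htower.isAbelianProj, htower.isCentralSupport,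
    fun κ V hV => htower.isGraphing_elim h𝒢 hAM h𝒢M hv hV, fun κ V hV => ?_, ?_,
    htower.cost_eq hτ (hAM p hpA) hvM⟩
  · have := hV.1
    exact htower.isTreeing_elim_iff hE h𝒢 hv hV.2.1
  · rw [NormalizingGroupoid.cost_transport htower hτ
        (fun l => h𝒢.mem_alg (htower.descent_mem_groupoid h𝒢 hv l)) (fun i => hAM _ (hfA i)) hUM,
      ← NormalizingGroupoid.cost_eq_add htower hτ hAM hvM hfA hUM hf hpiece,
      NormalizingGroupoid.cost_extend he]
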